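/- Let $M$ be a closed 3-manifold (compact, Hausdorff, without boundary) and let $\mathcal T$ be a triangulation of $M$, i.e. a finite abstract simplicial complex with vertices $1,\dots,N$ whose geometric realization is homeomorphic to $M$; let $\mathcal T_3$ be its set of tetrahedra. For $r\in\mathbb R^N_{>0}$ and a tetrahedron $\{ijkl\}\in\mathcal T_3$ put $$Q_{ijkl}(r)=\Big(\tfrac1{r_i}+\tfrac1{r_j}+\tfrac1{r_k}+\tfrac1{r_l}\Big)^2-2\Big(\tfrac1{r_i^2}+\tfrac1{r_j^2}+\tfrac1{r_k^2}+\tfrac1{r_l^2}\Big),$$ and let $\mathcal M_{\mathcal T}=\{r\in\mathbb R^N_{>0}: Q_{ijkl}(r)>0\ \text{for all}\ \{ijkl\}\in\mathcal T_3\}$ be the space of (real) ball packings. For $r\in\mathcal M_{\mathcal T}$ every $\{ijkl\}\in\mathcal T_3$ is realized as a nondegenerate Euclidean tetrahedron with edge lengths $l_{ij}=r_i+r_j$; let $\alpha_{ijkl}$ be its solid angle at the vertex $i$. Define $$K_i=4\pi-\sum_{\{ijkl\}\in\mathcal T_3}\alpha_{ijkl},\qquad \lambda(r)=\frac{\sum_{i=1}^N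 K_ir_i}{\sum_{i=1}^N r_i},$$ where the sum in $K_i$ is over the tetrahedra having $i$ as a vertex. A ball packing has constant curvature if all its $K_i$ are equal. Let $\hat r\in\mathcal M_{\mathcal T}$ have constant curvature, and define $$\chi(\hat r,\mathcal T)=\inf_{\gamma}\ \sup_{0\le t<a_\gamma}\lambda(\hat r+t\gamma),$$ where $\gamma$ ranges over the vectors of $\mathbb R^N$ with $\sum_i\gamma_i^2=1$ and $\sum_i\gamma_i=0$, and $a_\gamma$ is the least upper bound of the $a$ such that $\hat r+t\gamma\in\mathcal M_{\mathcal T}$ for all $0\le t<a$. Let $r_0\in\mathcal M_{\mathcal T}$ satisfy $\lambda(r_0)\le\chi(\hat r,\mathcal T)$. Then the normalized combinatorial Yamabe flow $$\frac{dr_i}{dt}=(\lambda-K_i)\,r_i,\qquad r(0)=r_0,$$ has a unique solution $r(t)$ in $\mathcal M_{\mathcal T}$, it exists for all $t\ge0$, and it converges exponentially fast to a constant curvature ball packing: there are a ball packing $r_\infty\in\mathcal M_{\mathcal T}$ with constant curvature and constants $C,c>0$ such that $\|r(t)-r_\infty\|\le Ce^{-ct}$ for all $t\ge0$. -/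

import Mathlib

open Set

noncomputable section

namespace BallPacking

/-- The geometric realization of a finite abstract simplicial complex `T` with vertex set `V`, in
barycentric coordinates: the points of the standard simplex whose support is a face of `T`. -/
def realization {V : Type*} [Fintype V] (T : AbstractSimplicialComplex V) : Set (V → ℝ) :=
  {x | x ∈ stdSimplex ℝ V ∧ (Finset.univ.filter fun v => x v ≠ 0) ∈ T.faces}

/-- `T` is a triangulation of the topological space `M`. -/
def Triangulates {V : Type*} [Fintype V] (T : AbstractSimplicialComplex V)
    (M : Type*) [TopologicalSpace M] : Prop :=
  Nonempty (realization T ≃ₜ M)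

/-- The angle between the sides of lengths `a` and `b` in a Euclidean triangle with side lengths
`a`, `b`, `c`. -/
def triangleAngle (a b c : ℝ) : ℝ :=
  Real.arccos ((a ^ 2 + b ^ 2 - c ^ 2) / (2 * a * b))

/-- The angle at the centre of the ball of radius `ri` in the triangle spanned by the centres of
three mutually externally tangent balls of radii `ri`, `rj`, `rk`. -/
def faceAngle (ri rj rk : ℝ) : ℝ :=
  triangleAngle (ri + rj) (ri + rk) (rj + rk)

/-- The dihedral angle at the edge `{ij}` of the Euclidean tetrahedron with vertices `i, j, k, l`
and edge lengths `ri + rj`, ..., `rk + rl`, that is, the angle between the faces `{ijk}` and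
`{ijl}`. It is the angle at `j` of the spherical triangle that the tetrahedron cuts out of the
unit sphere about `i`, whose sides are the three face angles at `i`. -/
def dihedralAngle (ri rj rk rl : ℝ) : ℝ :=
  Real.arccos
    ((Real.cos (faceAngle ri rk rl) -
        Real.cos (faceAngle ri rj rk) * Real.cos (faceAngle ri rj rl)) /
      (Real.sin (faceAngle ri rj rk) * Real.sin (faceAngle ri rj rl)))

/-- The solid angle at the vertex `i` of the Euclidean tetrahedron with vertices `i, j, k, l` and
edge lengths `ri + rj`, ..., `rk + rl`: the area of the spherical triangle that the tetrahedron
cuts out of the unit sphere about `i`, that is, the sum of its three angles (the dihedral angles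
at the three edges through `i`) minus `π`. -/
def solidAngle (ri rj rk rl : ℝ) : ℝ :=
  dihedralAngle ri rj rk rl + dihedralAngle ri rk rj rl + dihedralAngle ri rl rj rk - Real.pi

/-- The quantity `Q`; four positive radii are those of four mutually externally tangent balls
centred at the vertices of a nondegenerate Euclidean tetrahedron exactly if it is positive. -/
def descartesQ (ri rj rk rl : ℝ) : ℝ :=
  (1 / ri + 1 / rj + 1 / rk + 1 / rl) ^ 2 -
    2 * (1 / ri ^ 2 + 1 / rj ^ 2 + 1 / rk ^ 2 + 1 / rl ^ 2)

variable {V : Type*} [Fintype V] [DecidableEq V]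

/-- The set `{i, j, k, l}` is a tetrahedron of `T` (with four distinct vertices). -/
def IsTetrahedron (T : AbstractSimplicialComplex V) (i j k l : V) : Prop :=
  ({i, j, k, l} : Finset V) ∈ T.faces ∧ ({i, j, k, l} : Finset V).card = 4

/-- The space of (real) ball packings on `T`. -/
def packings (T : AbstractSimplicialComplex V) : Set (V → ℝ) :=
  {r | (∀ i, 0 < r i) ∧
    ∀ i j k l, IsTetrahedron T i j k l → 0 < descartesQ (r i) (r j) (r k) (r l)}

open Classical in
/-- The combinatorial scalar curvature at the vertex `i`: `4π` minus the sum of the solid angles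
at `i` of all tetrahedra with vertex `i`. Each such tetrahedron is `{i, j, k, l}` for six
ordered triples `(j, k, l)`, which all give the same solid angle; hence the factor `1 / 6`. -/
def curvature (T : AbstractSimplicialComplex V) (r : V → ℝ) (i : V) : ℝ :=
  4 * Real.pi - (1 / 6) * ∑ j, ∑ k, ∑ l,
    if IsTetrahedron T i j k l then solidAngle (r i) (r j) (r k) (r l) else 0

/-- The Cooper-Rivin-Glickenstein functional `λ`, the average scalar curvature. -/
def avgCurvature (T : AbstractSimplicialComplex V) (r : V → ℝ) : ℝ :=
  (∑ i, curvature T r i * r i) / ∑ i, r i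

/-- `r` is a real ball packing with constant curvature. -/
def IsConstantCurvaturePacking (T : AbstractSimplicialComplex V) (r : V → ℝ) : Prop :=
  r ∈ packings T ∧ ∃ c : ℝ, ∀ i, curvature T r i = c

/-- The least upper bound of the `a` for which `r + t γ` is a ball packing for all `0 ≤ t < a`.
It is finite for the directions `γ` of `directions V`, which have a negative coordinate. -/
def exitTime (T : AbstractSimplicialComplex V) (r γ : V → ℝ) : ℝ :=
  sSup {a : ℝ | ∀ t ∈ Ico 0 a, r + t • γ ∈ packings T}

/-- The Euclidean unit vectors whose coordinates sum to zero. -/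
def directions (V : Type*) [Fintype V] : Set (V → ℝ) :=
  {γ | ∑ i, γ i ^ 2 = 1 ∧ ∑ i, γ i = 0}

/-- The invariant `χ(r, T)`, as an extended real (so that no convention on unbounded suprema and
infima is needed). -/
def chi (T : AbstractSimplicialComplex V) (r : V → ℝ) : EReal :=
  ⨅ γ ∈ directions V, ⨆ t ∈ Ico 0 (exitTime T r γ), ((avgCurvature T (r + t • γ) : ℝ) : EReal)

/-- On the time interval `I`, the curve `r` stays in the space of ball packings and solves the
normalized combinatorial Yamabe flow `dr_i/dt = (λ - K_i) r_i`. -/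
def IsNormalizedYamabeFlowOn (T : AbstractSimplicialComplex V) (r : ℝ → V → ℝ) (I : Set ℝ) :
    Prop :=
  ∀ t ∈ I, r t ∈ packings T ∧
    ∀ i, HasDerivWithinAt (fun s => r s i)
      ((avgCurvature T (r t) - curvature T (r t) i) * r t i) I t

end BallPacking

end

open Set

set_option linter.unusedSectionVars false

noncomputable section

namespace BallPacking

/-! The flow is governed by the total curvature `S(r) = ∑ K_i r_i`. Clamped arcsines extend the
solid angles, and hence `S`, continuously to all positive radii (`bendSolidAngle`). By Schläfli's
formula the gradient of `S` is `K`. The second derivative of `S` is a sum over tetrahedra of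
quadratic forms in the ratios `η_i / r_i`: where `Q > 0` such a form is positive modulo constants
(`dirichletForm_pos`), where `Q < 0` it contributes nothing. So `S` is convex on segments that start
at a packing (`monotoneOn_lineDerivTotal`), and a packing `r̂` of constant curvature minimizes `S`
among positive radii with the same sum.

Along rays from `r̂` with fixed sum, `S` increases. Hence `chi` is a barrier: positive radii with
the sum of `r̂` and with average curvature below `chi` are packings (`mem_packings_of_lt_chi`), and
the sublevel sets there are compact (`exists_compact_sublevel`). If `λ(r̂) < chi`, the second
derivative at `r̂` is definite on vectors of sum zero, since a null direction would only rescale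
each tetrahedron and keep `λ` constant on its ray (`eq_zero_of_form_eq_zero`). Convexity turns this
into global quadratic growth of `S` (`exists_quadratic_growth`).

Scale so that `r₀` and `r̂` have equal sums. The flow preserves the sum and decreases `S`. If `λ(r₀)
≤ λ(r̂)`, then `r₀` is itself a minimizer and is stationary. Otherwise a short time brings `λ`
strictly below `chi`, and from then on the flow is confined to a compact set of packings, so it
exists forever. Quadratic growth and the gradient inequality bound `S - S(r̂)` by a multiple of the
dissipation (`exists_dissipation_ge`), so it decays exponentially, and with it the distance to `r̂`.
-/

/-! ### A single tetrahedron -/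

/-- The quantity `Q` in terms of the curvatures `1 / r`. -/
def bendQ (x y z w : ℝ) : ℝ := (x + y + z + w) ^ 2 - 2 * (x ^ 2 + y ^ 2 + z ^ 2 + w ^ 2)

/-- The second elementary symmetric function of the curvatures of a face. -/
def faceE (x y z : ℝ) : ℝ := x * y + y * z + x * z

/-- For four balls with curvatures `x, y, z, w`, the angle along the edges of the face `{x, y, z}`
between this face and the planes through the centre of the sphere tangent to the six edges. The
clamping of `arcsin` extends it continuously to all positive curvatures. -/
def bendAngle (x y z w : ℝ) : ℝ := Real.arcsin ((x + y + z - w) / (2 * √(faceE x y z)))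

/-- The solid angle in terms of the curvatures, extended to all positive curvatures. -/
def bendSolidAngle (x y z w : ℝ) : ℝ :=
  2 * (bendAngle x y z w + bendAngle x y w z + bendAngle x z w y) - Real.pi

/-- The conductance of the edge between the first two balls in the derivative of the solid
angles. -/
def conductance (x y z w : ℝ) : ℝ :=
  x * y * (x * (y + z + w) + y * (x + z + w) - (z - w) ^ 2) / (faceE x y z * faceE x y w)

lemma faceE_pos {x y z : ℝ} (hx : 0 < x) (hy : 0 < y) (hz : 0 < z) : 0 < faceE x y z := by
  unfold faceE; positivity

lemma four_mul_faceE (x y z w : ℝ) : 4 * faceE x y z = bendQ x y z w + (x + y + z - w) ^ 2 := by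
  unfold faceE bendQ; ring

/-- Hence the arcsine in `bendAngle` is clamped precisely when `bendQ` is negative, that is, when
the tetrahedron does not exist. -/
lemma one_sub_sq_bend {x y z : ℝ} (w : ℝ) (he : 0 < faceE x y z) :
    1 - ((x + y + z - w) / (2 * √(faceE x y z))) ^ 2 = bendQ x y z w / (4 * faceE x y z) := by
  have h := four_mul_faceE x y z w
  rw [div_pow, mul_pow, Real.sq_sqrt he.le]
  field_simp
  linarith

lemma cos_bendAngle {x y z w : ℝ} (he : 0 < faceE x y z) :
    Real.cos (bendAngle x y z w) = √(bendQ x y z w) / (2 * √(faceE x y z)) := by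
  rw [bendAngle, Real.cos_arcsin, one_sub_sq_bend w he, Real.sqrt_div' _ (by positivity),
    Real.sqrt_mul (by norm_num)]
  norm_num

lemma sin_bendAngle {x y z w : ℝ} (he : 0 < faceE x y z) (hQ : 0 ≤ bendQ x y z w) :
    Real.sin (bendAngle x y z w) = (x + y + z - w) / (2 * √(faceE x y z)) := by
  have h := one_sub_sq_bend w he
  have h2 : 0 ≤ bendQ x y z w / (4 * faceE x y z) := by positivity
  have h3 := abs_le_one_iff_mul_self_le_one.2
    (show (x + y + z - w) / (2 * √(faceE x y z)) * ((x + y + z - w) / (2 * √(faceE x y z))) ≤ 1 by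
      nlinarith)
  rw [bendAngle, Real.sin_arcsin (neg_le_of_abs_le h3) (le_of_abs_le h3)]

/-- Places the sum in the range of `arccos`, so that `dihedralAngle_eq` can be proved by comparing
cosines. -/
lemma bendAngle_add_nonneg {x y z w : ℝ} (hx : 0 < x) (hy : 0 < y) (hz : 0 < z) (hw : 0 < w)
    (hQ : 0 ≤ bendQ x y z w) : 0 ≤ bendAngle x y z w + bendAngle x y w z := by
  have he := faceE_pos hx hy hz
  have hf := faceE_pos hx hy hw
  have h1 := four_mul_faceE x y z w
  have h2 := four_mul_faceE x y w z
  have hQ' : bendQ x y w z = bendQ x y z w := by unfold bendQ; ring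
  rw [hQ'] at h2
  have key : -((x + y + w - z) / (2 * √(faceE x y w))) ≤
      (x + y + z - w) / (2 * √(faceE x y z)) := by
    rw [← neg_div, div_le_div_iff₀ (by positivity) (by positivity)]
    -- At most one of `a`, `b` is negative. With `q` the common value of `4 e - a²` and `4 f - b²`,
    -- one has `4 (a² f - b² e) = q (a² - b²)`, which decides the comparison after squaring.
    have aux : ∀ e f a b : ℝ, 0 < e → 0 < f → 0 < a + b → 4 * e - a ^ 2 = 4 * f - b ^ 2 →
        0 ≤ 4 * e - a ^ 2 → -b * √e ≤ a * √f := by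
      intro e f a b he hf hab h h'
      by_cases ha : 0 ≤ a
      · by_cases hb : 0 ≤ b
        · have := mul_nonneg hb (Real.sqrt_nonneg e)
          have := mul_nonneg ha (Real.sqrt_nonneg f)
          linarith
        · push Not at hb
          apply le_of_sq_le_sq _ (by positivity)
          rw [mul_pow, mul_pow, Real.sq_sqrt he.le, Real.sq_sqrt hf.le]
          nlinarith [mul_nonneg h' (show 0 ≤ a ^ 2 - b ^ 2 by nlinarith)]
      · push Not at ha
        have hb : 0 < b := by linarith
        have : -a * √f ≤ b * √e := by
          apply le_of_sq_le_sq _ (by positivity)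
          rw [mul_pow, mul_pow, Real.sq_sqrt he.le, Real.sq_sqrt hf.le]
          nlinarith [mul_nonneg h' (show 0 ≤ b ^ 2 - a ^ 2 by nlinarith)]
        linarith
    have := aux (faceE x y z) (faceE x y w) (x + y + z - w) (x + y + w - z) he hf (by linarith)
      (by linarith) (by linarith)
    linarith
  have := Real.monotone_arcsin key
  rw [Real.arcsin_neg] at this
  unfold bendAngle
  linarith

lemma descartesQ_eq (a b c d : ℝ) : descartesQ a b c d = bendQ a⁻¹ b⁻¹ c⁻¹ d⁻¹ := by
  unfold descartesQ bendQ; simp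

lemma cos_sin_faceAngle {a b c : ℝ} (ha : 0 < a) (hb : 0 < b) (hc : 0 < c) :
    Real.cos (faceAngle a b c) = 1 - 2 * (b * c) / ((a + b) * (a + c)) ∧
    Real.sin (faceAngle a b c) = 2 * √(a * b * c * (a + b + c)) / ((a + b) * (a + c)) := by
  have h0 : ((a + b) ^ 2 + (a + c) ^ 2 - (b + c) ^ 2) / (2 * (a + b) * (a + c)) =
      1 - 2 * (b * c) / ((a + b) * (a + c)) := by
    field_simp; ring
  have h1 : 2 * (b * c) / ((a + b) * (a + c)) ≤ 2 := by
    rw [div_le_iff₀ (by positivity)]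
    nlinarith [mul_pos ha hb, mul_pos ha hc, mul_pos ha ha]
  have h2 : 0 ≤ 2 * (b * c) / ((a + b) * (a + c)) := by positivity
  unfold faceAngle triangleAngle
  rw [h0, Real.cos_arccos (by linarith) (by linarith), Real.sin_arccos]
  refine ⟨rfl, ?_⟩
  have h3 : 1 - (1 - 2 * (b * c) / ((a + b) * (a + c))) ^ 2 =
      2 ^ 2 * (a * b * c * (a + b + c)) / ((a + b) * (a + c)) ^ 2 := by
    field_simp; ring
  rw [h3, Real.sqrt_div (by positivity), Real.sqrt_sq (by positivity),
    Real.sqrt_mul (by positivity), Real.sqrt_sq (by norm_num)]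

/-- The plane through the edge and the centre of the sphere tangent to all six edges cuts the
dihedral angle into the two bend angles. -/
lemma dihedralAngle_eq {a b c d : ℝ} (ha : 0 < a) (hb : 0 < b) (hc : 0 < c) (hd : 0 < d)
    (hQ : 0 < descartesQ a b c d) :
    dihedralAngle a b c d = bendAngle a⁻¹ b⁻¹ c⁻¹ d⁻¹ + bendAngle a⁻¹ b⁻¹ d⁻¹ c⁻¹ := by
  rw [descartesQ_eq] at hQ
  have hx := inv_pos.2 ha
  have hy := inv_pos.2 hb
  have hz := inv_pos.2 hc
  have hw := inv_pos.2 hd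
  have hQ' : bendQ a⁻¹ b⁻¹ d⁻¹ c⁻¹ = bendQ a⁻¹ b⁻¹ c⁻¹ d⁻¹ := by unfold bendQ; ring
  have he := faceE_pos hx hy hz
  have hf := faceE_pos hx hy hw
  have h0 := bendAngle_add_nonneg hx hy hz hw hQ.le
  have h1 : bendAngle a⁻¹ b⁻¹ c⁻¹ d⁻¹ + bendAngle a⁻¹ b⁻¹ d⁻¹ c⁻¹ ≤ Real.pi := by
    have h2 : bendAngle a⁻¹ b⁻¹ c⁻¹ d⁻¹ ≤ Real.pi / 2 := Real.arcsin_le_pi_div_two _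
    have h3 : bendAngle a⁻¹ b⁻¹ d⁻¹ c⁻¹ ≤ Real.pi / 2 := Real.arcsin_le_pi_div_two _
    linarith
  have hcos : Real.cos (bendAngle a⁻¹ b⁻¹ c⁻¹ d⁻¹ + bendAngle a⁻¹ b⁻¹ d⁻¹ c⁻¹) =
      (bendQ a⁻¹ b⁻¹ c⁻¹ d⁻¹ - (a⁻¹ + b⁻¹ + c⁻¹ - d⁻¹) * (a⁻¹ + b⁻¹ + d⁻¹ - c⁻¹)) /
        (4 * √(faceE a⁻¹ b⁻¹ c⁻¹ * faceE a⁻¹ b⁻¹ d⁻¹)) := by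
    rw [Real.cos_add, cos_bendAngle he, cos_bendAngle hf, sin_bendAngle he hQ.le,
      sin_bendAngle hf (hQ'.symm ▸ hQ.le), hQ', Real.sqrt_mul he.le]
    have := Real.mul_self_sqrt hQ.le
    rw [div_mul_div_comm, this, div_mul_div_comm, ← sub_div]
    congr 1
    ring
  have hsq : √(faceE a⁻¹ b⁻¹ c⁻¹ * faceE a⁻¹ b⁻¹ d⁻¹) =
      √((a * b * c * (a + b + c)) * (a * b * d * (a + b + d))) / (a ^ 2 * b ^ 2 * c * d) := by
    rw [eq_div_iff (by positivity), ← Real.sqrt_sq (show 0 ≤ a ^ 2 * b ^ 2 * c * d by positivity),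
      ← Real.sqrt_mul (by positivity)]
    congr 1
    unfold faceE
    field_simp
    ring
  rw [dihedralAngle, ← Real.arccos_cos h0 h1, hcos]
  congr 1
  obtain ⟨c1, -⟩ := cos_sin_faceAngle ha hc hd
  obtain ⟨c2, s2⟩ := cos_sin_faceAngle ha hb hc
  obtain ⟨c3, s3⟩ := cos_sin_faceAngle ha hb hd
  rw [c1, c2, c3, s2, s3, hsq, Real.sqrt_mul (show 0 ≤ a * b * c * (a + b + c) by positivity)]
  have h7 : 0 < √(a * b * c * (a + b + c)) := Real.sqrt_pos.2 (by positivity)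
  have h8 : 0 < √(a * b * d * (a + b + d)) := Real.sqrt_pos.2 (by positivity)
  generalize √(a * b * c * (a + b + c)) = p at *
  generalize √(a * b * d * (a + b + d)) = q at *
  unfold bendQ
  field_simp
  ring

lemma bendAngle_perm (x y z w : ℝ) :
    bendAngle x y z w = bendAngle y x z w ∧ bendAngle x y z w = bendAngle x z y w := by
  constructor <;> · unfold bendAngle faceE; ring_nf

lemma solidAngle_eq {a b c d : ℝ} (ha : 0 < a) (hb : 0 < b) (hc : 0 < c) (hd : 0 < d)
    (hQ : 0 < descartesQ a b c d) :
    solidAngle a b c d = bendSolidAngle a⁻¹ b⁻¹ c⁻¹ d⁻¹ := by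
  have h1 : descartesQ a c b d = descartesQ a b c d := by unfold descartesQ; ring
  have h2 : descartesQ a d b c = descartesQ a b c d := by unfold descartesQ; ring
  rw [solidAngle, dihedralAngle_eq ha hb hc hd hQ, dihedralAngle_eq ha hc hb hd (h1 ▸ hQ),
    dihedralAngle_eq ha hd hb hc (h2 ▸ hQ), bendSolidAngle,
    (bendAngle_perm a⁻¹ c⁻¹ b⁻¹ d⁻¹).2, (bendAngle_perm a⁻¹ d⁻¹ b⁻¹ c⁻¹).2,
    (bendAngle_perm a⁻¹ d⁻¹ c⁻¹ b⁻¹).2]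
  ring

/-! ### The derivative of the solid angles -/

/-- For negative `bendQ` the formula remains correct: the clamped arcsine is locally constant, and
`1 / √Q` is `1 / 0 = 0`. -/
lemma hasDerivAt_bendAngle {x y z w : ℝ → ℝ} {x' y' z' w' t : ℝ}
    (hx : HasDerivAt x x' t) (hy : HasDerivAt y y' t) (hz : HasDerivAt z z' t)
    (hw : HasDerivAt w w' t) (he : 0 < faceE (x t) (y t) (z t))
    (hQ : bendQ (x t) (y t) (z t) (w t) ≠ 0) :
    HasDerivAt (fun s => bendAngle (x s) (y s) (z s) (w s))
      (1 / √(bendQ (x t) (y t) (z t) (w t)) *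
        ((x' + y' + z' - w') - (x t + y t + z t - w t) *
          (x' * (y t + z t) + y' * (x t + z t) + z' * (x t + y t)) /
          (2 * faceE (x t) (y t) (z t)))) t := by
  have hE : HasDerivAt (fun s => faceE (x s) (y s) (z s))
      (x' * (y t + z t) + y' * (x t + z t) + z' * (x t + y t)) t := by
    refine (((hx.mul hy).add (hy.mul hz)).add (hx.mul hz)).congr_deriv ?_
    ring
  have h1 := one_sub_sq_bend (w t) he
  have hne : bendQ (x t) (y t) (z t) (w t) / (4 * faceE (x t) (y t) (z t)) ≠ 0 := by
    positivity
  have hpos := Real.sqrt_pos.2 he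
  have hd := (((hx.add hy).add hz).sub hw).div ((hE.sqrt he.ne').const_mul 2)
    (by positivity)
  refine ((Real.hasDerivAt_arcsin (x := (x t + y t + z t - w t) /
    (2 * √(faceE (x t) (y t) (z t)))) ?_ ?_).comp t hd).congr_deriv ?_
  · intro h; rw [h] at h1; norm_num at h1; exact hne h1.symm
  · intro h; rw [h] at h1; norm_num at h1; exact hne h1.symm
  · rw [h1, Real.sqrt_div' _ (by positivity), Real.sqrt_mul (by norm_num)]
    have h4 : √(4 : ℝ) = 2 := by
      rw [show (4 : ℝ) = 2 ^ 2 by norm_num, Real.sqrt_sq (by norm_num)]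
    rw [h4]
    have hs := Real.sq_sqrt he.le
    simp only [Pi.add_apply, Pi.sub_apply]
    generalize √(faceE (x t) (y t) (z t)) = p at *
    rw [← hs, one_div_div]
    by_cases hq : √(bendQ (x t) (y t) (z t) (w t)) = 0
    · simp [hq]
    · field_simp

lemma conductance_symm (x y z w : ℝ) : conductance x y z w = conductance y x z w := by
  unfold conductance faceE; ring_nf

/-- Scale invariance leaves only differences of the relative rates `r' / r`, so the derivative is a
weighted graph Laplacian on the four vertices. The symmetry of the weights yields both Schläfli's
formula and the quadratic form below. -/
lemma hasDerivAt_bendSolidAngle {a b c d : ℝ → ℝ} {a' b' c' d' t : ℝ}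
    (ha : HasDerivAt a a' t) (hb : HasDerivAt b b' t) (hc : HasDerivAt c c' t)
    (hd : HasDerivAt d d' t) (ha0 : 0 < a t) (hb0 : 0 < b t) (hc0 : 0 < c t) (hd0 : 0 < d t)
    (hQ : descartesQ (a t) (b t) (c t) (d t) ≠ 0) :
    HasDerivAt (fun s => bendSolidAngle (a s)⁻¹ (b s)⁻¹ (c s)⁻¹ (d s)⁻¹)
      (1 / √(descartesQ (a t) (b t) (c t) (d t)) * ((a t)⁻¹ *
        (conductance (a t)⁻¹ (b t)⁻¹ (c t)⁻¹ (d t)⁻¹ * (b' * (b t)⁻¹ - a' * (a t)⁻¹) +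
         conductance (a t)⁻¹ (c t)⁻¹ (b t)⁻¹ (d t)⁻¹ * (c' * (c t)⁻¹ - a' * (a t)⁻¹) +
         conductance (a t)⁻¹ (d t)⁻¹ (b t)⁻¹ (c t)⁻¹ * (d' * (d t)⁻¹ - a' * (a t)⁻¹)))) t := by
  rw [descartesQ_eq] at hQ ⊢
  have hx := ha.inv ha0.ne'
  have hy := hb.inv hb0.ne'
  have hz := hc.inv hc0.ne'
  have hw := hd.inv hd0.ne'
  have hx0 := inv_pos.2 ha0
  have hy0 := inv_pos.2 hb0
  have hz0 := inv_pos.2 hc0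
  have hw0 := inv_pos.2 hd0
  have q1 : bendQ (a t)⁻¹ (b t)⁻¹ (d t)⁻¹ (c t)⁻¹ = bendQ (a t)⁻¹ (b t)⁻¹ (c t)⁻¹ (d t)⁻¹ := by
    unfold bendQ; ring
  have q2 : bendQ (a t)⁻¹ (c t)⁻¹ (d t)⁻¹ (b t)⁻¹ = bendQ (a t)⁻¹ (b t)⁻¹ (c t)⁻¹ (d t)⁻¹ := by
    unfold bendQ; ring
  have h1 := hasDerivAt_bendAngle hx hy hz hw (faceE_pos hx0 hy0 hz0) hQ
  have h2 := hasDerivAt_bendAngle hx hy hw hz (faceE_pos hx0 hy0 hw0) (q1.symm ▸ hQ)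
  have h3 := hasDerivAt_bendAngle hx hz hw hy (faceE_pos hx0 hz0 hw0) (q2.symm ▸ hQ)
  refine ((((h1.add h2).add h3).const_mul 2).sub_const Real.pi).congr_deriv ?_
  simp only [Pi.inv_apply]
  rw [q1, q2]
  generalize √(bendQ (a t)⁻¹ (b t)⁻¹ (c t)⁻¹ (d t)⁻¹) = q
  have e1 : -a' / a t ^ 2 = -(a' * (a t)⁻¹) * (a t)⁻¹ := by field_simp
  have e2 : -b' / b t ^ 2 = -(b' * (b t)⁻¹) * (b t)⁻¹ := by field_simp
  have e3 : -c' / c t ^ 2 = -(c' * (c t)⁻¹) * (c t)⁻¹ := by field_simp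
  have e4 : -d' / d t ^ 2 = -(d' * (d t)⁻¹) * (d t)⁻¹ := by field_simp
  rw [e1, e2, e3, e4]
  generalize a' * (a t)⁻¹ = u1 at *
  generalize b' * (b t)⁻¹ = u2 at *
  generalize c' * (c t)⁻¹ = u3 at *
  generalize d' * (d t)⁻¹ = u4 at *
  generalize (a t)⁻¹ = x at *
  generalize (b t)⁻¹ = y at *
  generalize (c t)⁻¹ = z at *
  generalize (d t)⁻¹ = w at *
  rw [mul_comm 2, ← mul_add, ← mul_add, mul_assoc]
  congr 1
  have p1 := faceE_pos hx0 hy0 hz0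
  have p2 := faceE_pos hx0 hy0 hw0
  have p3 := faceE_pos hx0 hz0 hw0
  unfold conductance
  have r1 : faceE x z y = faceE x y z := by unfold faceE; ring
  have r2 : faceE x w y = faceE x y w := by unfold faceE; ring
  have r3 : faceE x w z = faceE x z w := by unfold faceE; ring
  rw [r1, r2, r3]
  field_simp
  unfold faceE
  ring

/-! ### Definiteness of the derivative of the solid angles -/

/-- Sylvester's criterion for ternary quadratic forms. -/
lemma quadForm_pos_of_minors {A B C D E F : ℝ} (h1 : 0 < A) (h2 : 0 < A * D - B ^ 2)
    (h3 : 0 < A * D * F + 2 * B * C * E - A * E ^ 2 - D * C ^ 2 - F * B ^ 2) (x y z : ℝ)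
    (h : ¬ (x = 0 ∧ y = 0 ∧ z = 0)) :
    0 < A * x ^ 2 + 2 * B * x * y + 2 * C * x * z + D * y ^ 2 + 2 * E * y * z + F * z ^ 2 := by
  set m := A * D - B ^ 2
  set M := A * D * F + 2 * B * C * E - A * E ^ 2 - D * C ^ 2 - F * B ^ 2
  have key : A * m * (A * x ^ 2 + 2 * B * x * y + 2 * C * x * z + D * y ^ 2 + 2 * E * y * z +
      F * z ^ 2) = m * (A * x + B * y + C * z) ^ 2 + (m * y + (A * E - B * C) * z) ^ 2 +
        A * M * z ^ 2 := by
    simp only [m, M]; ring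
  have : 0 < m * (A * x + B * y + C * z) ^ 2 + (m * y + (A * E - B * C) * z) ^ 2 +
      A * M * z ^ 2 := by
    by_cases hz : z = 0
    · by_cases hy : y = 0
      · have hx : x ≠ 0 := fun hx => h ⟨hx, hy, hz⟩
        have : A * x ≠ 0 := mul_ne_zero h1.ne' hx
        simp only [hz, hy, mul_zero, add_zero]
        positivity
      · simp only [hz]
        have : m * y ≠ 0 := mul_ne_zero h2.ne' hy
        have : 0 < (m * y) ^ 2 := by positivity
        have : 0 ≤ m * (A * x + B * y) ^ 2 := by positivity
        simp only [mul_zero, add_zero]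
        nlinarith
    · positivity
  rw [← key] at this
  exact pos_of_mul_pos_right this (by positivity)

/-- A single conductance can be negative because of the term `(z - w) ^ 2`, so definiteness is not
termwise. Instead the principal minors of the reduced Laplacian, multiplied by face polynomials,
become visibly positive polynomials in the bends and `bendQ`. -/
lemma sum_conductance_pos {x y z w : ℝ} (hx : 0 < x) (hy : 0 < y) (hz : 0 < z) (hw : 0 < w)
    (hQ : 0 < bendQ x y z w) :
    0 < conductance x y z w + conductance x z y w + conductance x w y z := by
  have p1 := faceE_pos hx hy hz
  have p2 := faceE_pos hx hy hw
  have p3 := faceE_pos hx hz hw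
  have r1 : faceE x z y = faceE x y z := by unfold faceE; ring
  have r2 : faceE x w y = faceE x y w := by unfold faceE; ring
  have r3 : faceE x w z = faceE x z w := by unfold faceE; ring
  have key : (conductance x y z w + conductance x z y w + conductance x w y z) *
      (faceE x y z * faceE x y w * faceE x z w) =
      x * (2 * (y * z * w) * bendQ x y z w + x * ((y * z + z * w + y * w) * bendQ x y z w +
        x ^ 2 * (y * z + z * w + y * w) + y * z * w * (y + z + w) +
        x * (y ^ 2 * (z + w) + z ^ 2 * (y + w) + w ^ 2 * (y + z) + 2 * (y * z * w)))) := by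
    unfold conductance
    rw [r1, r2, r3]
    field_simp
    unfold faceE bendQ
    ring
  have : 0 < (conductance x y z w + conductance x z y w + conductance x w y z) *
      (faceE x y z * faceE x y w * faceE x z w) := by
    rw [key]; positivity
  exact pos_of_mul_pos_left this (by positivity)

lemma conductance_minor_pos {x y z w : ℝ} (hx : 0 < x) (hy : 0 < y) (hz : 0 < z) (hw : 0 < w)
    (hQ : 0 < bendQ x y z w) :
    0 < (conductance x y z w + conductance x z y w + conductance x w y z) *
      (conductance x y z w + conductance y z x w + conductance y w x z) -
      conductance x y z w ^ 2 := by
  have p1 := faceE_pos hx hy hz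
  have p2 := faceE_pos hx hy hw
  have p3 := faceE_pos hx hz hw
  have p4 := faceE_pos hy hz hw
  have r1 : faceE x z y = faceE x y z := by unfold faceE; ring
  have r2 : faceE x w y = faceE x y w := by unfold faceE; ring
  have r3 : faceE x w z = faceE x z w := by unfold faceE; ring
  have r4 : faceE y z x = faceE x y z := by unfold faceE; ring
  have r5 : faceE y w x = faceE x y w := by unfold faceE; ring
  have r6 : faceE y w z = faceE y z w := by unfold faceE; ring
  have key : ((conductance x y z w + conductance x z y w + conductance x w y z) *
      (conductance x y z w + conductance y z x w + conductance y w x z) -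
      conductance x y z w ^ 2) * (faceE x y z * faceE x y w * faceE x z w * faceE y z w) =
      bendQ x y z w * (x * y * (x * y * (3 * (z + w) ^ 2 - 8 * (z * w)) +
        2 * (z * w) * (x + y) * (z + w) + 2 * (z * w) * (x + y) ^ 2 +
        2 * (z * w) * bendQ x y z w)) := by
    unfold conductance
    rw [r1, r2, r3, r4, r5, r6]
    field_simp
    unfold faceE bendQ
    ring
  have h1 : 0 ≤ 3 * (z + w) ^ 2 - 8 * (z * w) := by nlinarith [sq_nonneg (z - w)]
  have : 0 < ((conductance x y z w + conductance x z y w + conductance x w y z) *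
      (conductance x y z w + conductance y z x w + conductance y w x z) -
      conductance x y z w ^ 2) * (faceE x y z * faceE x y w * faceE x z w * faceE y z w) := by
    rw [key]; positivity
  exact pos_of_mul_pos_left this (by positivity)

lemma conductance_det_pos {x y z w : ℝ} (hx : 0 < x) (hy : 0 < y) (hz : 0 < z) (hw : 0 < w)
    (hQ : 0 < bendQ x y z w) {A B C D E F : ℝ}
    (hA : A = conductance x y z w + conductance x z y w + conductance x w y z)
    (hB : B = -conductance x y z w) (hC : C = -conductance x z y w)
    (hD : D = conductance x y z w + conductance y z x w + conductance y w x z)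
    (hE : E = -conductance y z x w)
    (hF : F = conductance x z y w + conductance y z x w + conductance z w x y) :
    0 < A * D * F + 2 * B * C * E - A * E ^ 2 - D * C ^ 2 - F * B ^ 2 := by
  have p1 := faceE_pos hx hy hz
  have p2 := faceE_pos hx hy hw
  have p3 := faceE_pos hx hz hw
  have p4 := faceE_pos hy hz hw
  have r1 : faceE x z y = faceE x y z := by unfold faceE; ring
  have r2 : faceE x w y = faceE x y w := by unfold faceE; ring
  have r3 : faceE x w z = faceE x z w := by unfold faceE; ring
  have r4 : faceE y z x = faceE x y z := by unfold faceE; ring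
  have r5 : faceE y w x = faceE x y w := by unfold faceE; ring
  have r6 : faceE y w z = faceE y z w := by unfold faceE; ring
  have r7 : faceE z w x = faceE x z w := by unfold faceE; ring
  have r8 : faceE z w y = faceE y z w := by unfold faceE; ring
  have key : (A * D * F + 2 * B * C * E - A * E ^ 2 - D * C ^ 2 - F * B ^ 2) *
      (faceE x y z * faceE x y w * faceE x z w * faceE y z w) =
      6 * (x * y * z * w) * bendQ x y z w ^ 2 := by
    rw [hA, hB, hC, hD, hE, hF]
    unfold conductance
    rw [r1, r2, r3, r4, r5, r6, r7, r8]
    field_simp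
    unfold faceE bendQ
    ring
  have : 0 < (A * D * F + 2 * B * C * E - A * E ^ 2 - D * C ^ 2 - F * B ^ 2) *
      (faceE x y z * faceE x y w * faceE x z w * faceE y z w) := by
    rw [key]; positivity
  exact pos_of_mul_pos_left this (by positivity)

/-- The Dirichlet form of the conductances. -/
def dirichletForm (x y z w a b c d : ℝ) : ℝ :=
  conductance x y z w * (b - a) ^ 2 + conductance x z y w * (c - a) ^ 2 +
    conductance x w y z * (d - a) ^ 2 + conductance y z x w * (c - b) ^ 2 +
    conductance y w x z * (d - b) ^ 2 + conductance z w x y * (d - c) ^ 2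

lemma dirichletForm_pos {x y z w : ℝ} (hx : 0 < x) (hy : 0 < y) (hz : 0 < z) (hw : 0 < w)
    (hQ : 0 < bendQ x y z w) {a b c d : ℝ} (h : ¬ (a = d ∧ b = d ∧ c = d)) :
    0 < dirichletForm x y z w a b c d := by
  have h1 := sum_conductance_pos hx hy hz hw hQ
  have h2 := conductance_minor_pos hx hy hz hw hQ
  have h3 := conductance_det_pos hx hy hz hw hQ rfl rfl rfl rfl rfl rfl
  rw [← neg_sq (conductance x y z w)] at h2
  -- The form depends only on differences; grounding the fourth vertex leaves the reduced Laplacian.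
  have := quadForm_pos_of_minors h1 h2 h3 (a - d) (b - d) (c - d)
    (by simpa only [sub_eq_zero] using h)
  convert this using 1
  unfold dirichletForm
  ring

/-! ### The extended curvature of a complex and its derivative -/

lemma dirichletForm_nonneg {x y z w : ℝ} (hx : 0 < x) (hy : 0 < y) (hz : 0 < z) (hw : 0 < w)
    (hQ : 0 < bendQ x y z w) (a b c d : ℝ) : 0 ≤ dirichletForm x y z w a b c d := by
  by_cases h : a = d ∧ b = d ∧ c = d
  · obtain ⟨rfl, rfl, rfl⟩ := h
    simp [dirichletForm]
  · exact (dirichletForm_pos hx hy hz hw hQ h).le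

lemma descartesQ_swap (a b c d : ℝ) :
    descartesQ b a c d = descartesQ a b c d ∧ descartesQ c a b d = descartesQ a b c d ∧
      descartesQ d a b c = descartesQ a b c d := by
  unfold descartesQ
  refine ⟨?_, ?_, ?_⟩ <;> ring

/-- The derivative of the solid angle at the first vertex in the direction `(a', b', c', d')`. -/
def solidAngleDeriv (a b c d a' b' c' d' : ℝ) : ℝ :=
  1 / √(descartesQ a b c d) * (a⁻¹ *
    (conductance a⁻¹ b⁻¹ c⁻¹ d⁻¹ * (b' * b⁻¹ - a' * a⁻¹) +
     conductance a⁻¹ c⁻¹ b⁻¹ d⁻¹ * (c' * c⁻¹ - a' * a⁻¹) +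
     conductance a⁻¹ d⁻¹ b⁻¹ c⁻¹ * (d' * d⁻¹ - a' * a⁻¹)))

/-- Schläfli's formula. -/
lemma schlaefli {a b c d : ℝ} (ha : a ≠ 0) (hb : b ≠ 0) (hc : c ≠ 0) (hd : d ≠ 0)
    (a' b' c' d' : ℝ) :
    a * solidAngleDeriv a b c d a' b' c' d' + b * solidAngleDeriv b a c d b' a' c' d' +
      c * solidAngleDeriv c a b d c' a' b' d' + d * solidAngleDeriv d a b c d' a' b' c' = 0 := by
  unfold solidAngleDeriv
  obtain ⟨q1, q2, q3⟩ := descartesQ_swap a b c d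
  rw [q1, q2, q3]
  have h1 := conductance_symm b⁻¹ a⁻¹ c⁻¹ d⁻¹
  have h2 := conductance_symm c⁻¹ a⁻¹ b⁻¹ d⁻¹
  have h3 := conductance_symm d⁻¹ a⁻¹ b⁻¹ c⁻¹
  have h4 := conductance_symm c⁻¹ b⁻¹ a⁻¹ d⁻¹
  have h5 := conductance_symm d⁻¹ b⁻¹ a⁻¹ c⁻¹
  have h6 := conductance_symm d⁻¹ c⁻¹ a⁻¹ b⁻¹
  rw [h1, h2, h3, h4, h5, h6]
  have e : ∀ x y z : ℝ, x ≠ 0 → x * (y * (x⁻¹ * z)) = y * z := by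
    intro x y z hx; field_simp
  rw [e _ _ _ ha, e _ _ _ hb, e _ _ _ hc, e _ _ _ hd]
  ring

lemma solidAngleDeriv_form (a b c d a' b' c' d' : ℝ) :
    a' * solidAngleDeriv a b c d a' b' c' d' + b' * solidAngleDeriv b a c d b' a' c' d' +
      c' * solidAngleDeriv c a b d c' a' b' d' + d' * solidAngleDeriv d a b c d' a' b' c' =
    -(1 / √(descartesQ a b c d) * dirichletForm a⁻¹ b⁻¹ c⁻¹ d⁻¹
      (a' * a⁻¹) (b' * b⁻¹) (c' * c⁻¹) (d' * d⁻¹)) := by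
  unfold solidAngleDeriv dirichletForm
  obtain ⟨q1, q2, q3⟩ := descartesQ_swap a b c d
  rw [q1, q2, q3]
  have h1 := conductance_symm b⁻¹ a⁻¹ c⁻¹ d⁻¹
  have h2 := conductance_symm c⁻¹ a⁻¹ b⁻¹ d⁻¹
  have h3 := conductance_symm d⁻¹ a⁻¹ b⁻¹ c⁻¹
  have h4 := conductance_symm c⁻¹ b⁻¹ a⁻¹ d⁻¹
  have h5 := conductance_symm d⁻¹ b⁻¹ a⁻¹ c⁻¹
  have h6 := conductance_symm d⁻¹ c⁻¹ a⁻¹ b⁻¹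
  rw [h1, h2, h3, h4, h5, h6]
  ring

section Sums

variable {V : Type*} [Fintype V]

lemma sum_rotate (f : V → V → V → V → ℝ) :
    (∑ i, ∑ j, ∑ k, ∑ l, f j i k l = ∑ i, ∑ j, ∑ k, ∑ l, f i j k l) ∧
    (∑ i, ∑ j, ∑ k, ∑ l, f k i j l = ∑ i, ∑ j, ∑ k, ∑ l, f i j k l) ∧
    (∑ i, ∑ j, ∑ k, ∑ l, f l i j k = ∑ i, ∑ j, ∑ k, ∑ l, f i j k l) := by
  have h3 : ∀ g : V → V → V → ℝ, ∑ i, ∑ j, ∑ k, g k i j = ∑ i, ∑ j, ∑ k, g i j k := by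
    intro g
    rw [Finset.sum_congr rfl fun i _ => Finset.sum_comm, Finset.sum_comm]
  refine ⟨Finset.sum_comm, h3 fun a b c => ∑ l, f a b c l, ?_⟩
  rw [Finset.sum_congr rfl fun i _ => h3 fun a b c => f a i b c, Finset.sum_comm]

/-- Turns sums over vertices into sums over tetrahedra, by averaging over which of the four vertices
is listed first. -/
lemma sum_symmetrize (y : V → ℝ) (f : V → V → V → V → ℝ) :
    ∑ i, y i * ∑ j, ∑ k, ∑ l, f i j k l = 1 / 4 * ∑ i, ∑ j, ∑ k, ∑ l,
      (y i * f i j k l + y j * f j i k l + y k * f k i j l + y l * f l i j k) := by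
  obtain ⟨h1, h2, h3⟩ := sum_rotate fun i j k l => y i * f i j k l
  simp only [Finset.sum_add_distrib, h1, h2, h3, Finset.mul_sum]
  simp only [← Finset.mul_sum]
  ring

end Sums

variable {V : Type*} [DecidableEq V]

lemma isTetrahedron_swap (T : AbstractSimplicialComplex V) (i j k l : V) :
    (IsTetrahedron T j i k l ↔ IsTetrahedron T i j k l) ∧
    (IsTetrahedron T k i j l ↔ IsTetrahedron T i j k l) ∧
    (IsTetrahedron T l i j k ↔ IsTetrahedron T i j k l) := by
  unfold IsTetrahedron
  have h1 : ({j, i, k, l} : Finset V) = {i, j, k, l} := by ext; simp; tauto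
  have h2 : ({k, i, j, l} : Finset V) = {i, j, k, l} := by ext; simp; tauto
  have h3 : ({l, i, j, k} : Finset V) = {i, j, k, l} := by ext; simp; tauto
  rw [h1, h2, h3]
  simp

variable [Fintype V]

open Classical in
/-- The combinatorial curvature, extended to all positive radii. -/
def extCurvature (T : AbstractSimplicialComplex V) (r : V → ℝ) (i : V) : ℝ :=
  4 * Real.pi - (1 / 6) * ∑ j, ∑ k, ∑ l,
    if IsTetrahedron T i j k l then bendSolidAngle (r i)⁻¹ (r j)⁻¹ (r k)⁻¹ (r l)⁻¹ else 0

open Classical in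
/-- The derivative of the curvature at `r` in the direction `r'`. -/
def curvatureDeriv (T : AbstractSimplicialComplex V) (r r' : V → ℝ) (i : V) : ℝ :=
  -((1 / 6) * ∑ j, ∑ k, ∑ l, if IsTetrahedron T i j k l then
    solidAngleDeriv (r i) (r j) (r k) (r l) (r' i) (r' j) (r' k) (r' l) else 0)

variable {T : AbstractSimplicialComplex V}

lemma extCurvature_eq {r : V → ℝ} (hr : r ∈ packings T) (i : V) :
    extCurvature T r i = curvature T r i := by
  unfold extCurvature curvature
  congr 2
  refine Finset.sum_congr rfl fun j _ => Finset.sum_congr rfl fun k _ =>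
    Finset.sum_congr rfl fun l _ => ?_
  split_ifs with h
  · exact (solidAngle_eq (hr.1 i) (hr.1 j) (hr.1 k) (hr.1 l) (hr.2 i j k l h)).symm
  · rfl

lemma hasDerivAt_extCurvature {r : ℝ → V → ℝ} {r' : V → ℝ} {t : ℝ}
    (hr : ∀ i, HasDerivAt (fun s => r s i) (r' i) t) (hpos : ∀ i, 0 < r t i)
    (hQ : ∀ i j k l, IsTetrahedron T i j k l →
      descartesQ (r t i) (r t j) (r t k) (r t l) ≠ 0) (i : V) :
    HasDerivAt (fun s => extCurvature T (r s) i) (curvatureDeriv T (r t) r' i) t := by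
  unfold extCurvature curvatureDeriv
  refine (HasDerivAt.const_mul (1 / 6 : ℝ) (HasDerivAt.fun_sum fun j _ =>
    HasDerivAt.fun_sum fun k _ => HasDerivAt.fun_sum fun l _ => ?_)).const_sub _
  split_ifs with h
  · exact hasDerivAt_bendSolidAngle (hr i) (hr j) (hr k) (hr l) (hpos i) (hpos j) (hpos k)
      (hpos l) (hQ i j k l h)
  · exact hasDerivAt_const _ _

open Classical in
lemma sum_mul_curvatureDeriv_eq (r η y : V → ℝ) :
    ∑ i, y i * curvatureDeriv T r η i = -(1 / 24 * ∑ i, ∑ j, ∑ k, ∑ l,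
      if IsTetrahedron T i j k l then
        y i * solidAngleDeriv (r i) (r j) (r k) (r l) (η i) (η j) (η k) (η l) +
        y j * solidAngleDeriv (r j) (r i) (r k) (r l) (η j) (η i) (η k) (η l) +
        y k * solidAngleDeriv (r k) (r i) (r j) (r l) (η k) (η i) (η j) (η l) +
        y l * solidAngleDeriv (r l) (r i) (r j) (r k) (η l) (η i) (η j) (η k) else 0) := by
  have h := sum_symmetrize y fun i j k l => if IsTetrahedron T i j k l then
    solidAngleDeriv (r i) (r j) (r k) (r l) (η i) (η j) (η k) (η l) else 0
  have h' : ∑ i, y i * curvatureDeriv T r η i = -(1 / 6) * ∑ i, y i * ∑ j, ∑ k, ∑ l,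
      if IsTetrahedron T i j k l then
        solidAngleDeriv (r i) (r j) (r k) (r l) (η i) (η j) (η k) (η l) else 0 := by
    rw [Finset.mul_sum]
    refine Finset.sum_congr rfl fun i _ => ?_
    unfold curvatureDeriv
    ring
  rw [h', h, ← mul_assoc, ← neg_mul, show -(1 / 6 : ℝ) * (1 / 4) = -(1 / 24) by norm_num]
  congr 1
  refine Finset.sum_congr rfl fun i _ => Finset.sum_congr rfl fun j _ =>
    Finset.sum_congr rfl fun k _ => Finset.sum_congr rfl fun l _ => ?_
  obtain ⟨h1, h2, h3⟩ := isTetrahedron_swap T i j k l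
  simp only [h1, h2, h3]
  split_ifs <;> ring

/-- Schläfli's formula summed over the complex; it makes the curvature the gradient of the total
curvature. -/
lemma sum_mul_curvatureDeriv {r : V → ℝ} (hr : ∀ i, r i ≠ 0) (r' : V → ℝ) :
    ∑ i, r i * curvatureDeriv T r r' i = 0 := by
  rw [sum_mul_curvatureDeriv_eq, neg_eq_zero]
  refine mul_eq_zero_of_right _ (Finset.sum_eq_zero fun i _ => Finset.sum_eq_zero fun j _ =>
    Finset.sum_eq_zero fun k _ => Finset.sum_eq_zero fun l _ => ?_)
  split_ifs
  · exact schlaefli (hr i) (hr j) (hr k) (hr l) _ _ _ _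
  · rfl

open Classical in
lemma curvatureDeriv_form (r η : V → ℝ) :
    ∑ i, η i * curvatureDeriv T r η i = 1 / 24 * ∑ i, ∑ j, ∑ k, ∑ l,
      if IsTetrahedron T i j k l then 1 / √(descartesQ (r i) (r j) (r k) (r l)) *
        dirichletForm (r i)⁻¹ (r j)⁻¹ (r k)⁻¹ (r l)⁻¹
          (η i * (r i)⁻¹) (η j * (r j)⁻¹) (η k * (r k)⁻¹) (η l * (r l)⁻¹) else 0 := by
  rw [sum_mul_curvatureDeriv_eq, ← mul_neg]
  simp only [← Finset.sum_neg_distrib]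
  congr 1
  refine Finset.sum_congr rfl fun i _ => Finset.sum_congr rfl fun j _ =>
    Finset.sum_congr rfl fun k _ => Finset.sum_congr rfl fun l _ => ?_
  split_ifs
  · rw [solidAngleDeriv_form, neg_neg]
  · rw [neg_zero]

/-- Where `Q ≤ 0` the factor `1 / √Q` is `0`, so degenerate tetrahedra do no harm to
semidefiniteness. -/
lemma dirichletTerm_nonneg {a b c d : ℝ} (ha : 0 < a) (hb : 0 < b) (hc : 0 < c) (hd : 0 < d)
    (a' b' c' d' : ℝ) :
    0 ≤ 1 / √(descartesQ a b c d) * dirichletForm a⁻¹ b⁻¹ c⁻¹ d⁻¹ a' b' c' d' := by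
  rcases le_or_gt (descartesQ a b c d) 0 with h | h
  · rw [Real.sqrt_eq_zero_of_nonpos h]; simp
  · exact mul_nonneg (by positivity) (dirichletForm_nonneg (inv_pos.2 ha) (inv_pos.2 hb)
      (inv_pos.2 hc) (inv_pos.2 hd) (descartesQ_eq a b c d ▸ h) _ _ _ _)

lemma curvatureDeriv_form_nonneg {r : V → ℝ} (hr : ∀ i, 0 < r i) (η : V → ℝ) :
    0 ≤ ∑ i, η i * curvatureDeriv T r η i := by
  rw [curvatureDeriv_form]
  refine mul_nonneg (by norm_num) (Finset.sum_nonneg fun i _ => Finset.sum_nonneg fun j _ =>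
    Finset.sum_nonneg fun k _ => Finset.sum_nonneg fun l _ => ?_)
  split_ifs
  · exact dirichletTerm_nonneg (hr i) (hr j) (hr k) (hr l) _ _ _ _
  · exact le_rfl

lemma ratio_eq_of_form_eq_zero {r : V → ℝ} (hr : r ∈ packings T) {η : V → ℝ}
    (h0 : ∑ i, η i * curvatureDeriv T r η i = 0) {i j k l : V} (h : IsTetrahedron T i j k l) :
    η i * (r i)⁻¹ = η l * (r l)⁻¹ ∧ η j * (r j)⁻¹ = η l * (r l)⁻¹ ∧
      η k * (r k)⁻¹ = η l * (r l)⁻¹ := by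
  classical
  have hnn : ∀ i j k l, (0 : ℝ) ≤ if IsTetrahedron T i j k l then
      1 / √(descartesQ (r i) (r j) (r k) (r l)) *
        dirichletForm (r i)⁻¹ (r j)⁻¹ (r k)⁻¹ (r l)⁻¹
          (η i * (r i)⁻¹) (η j * (r j)⁻¹) (η k * (r k)⁻¹) (η l * (r l)⁻¹) else 0 := by
    intro i j k l
    split_ifs
    · exact dirichletTerm_nonneg (hr.1 i) (hr.1 j) (hr.1 k) (hr.1 l) _ _ _ _
    · exact le_rfl
  rw [curvatureDeriv_form] at h0
  have h1 := (mul_eq_zero.1 h0).resolve_left (by norm_num)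
  have h2 := (Finset.sum_eq_zero_iff_of_nonneg fun i _ => Finset.sum_nonneg fun j _ =>
    Finset.sum_nonneg fun k _ => Finset.sum_nonneg fun l _ => hnn i j k l).1 h1 i
      (Finset.mem_univ i)
  have h3 := (Finset.sum_eq_zero_iff_of_nonneg fun j _ =>
    Finset.sum_nonneg fun k _ => Finset.sum_nonneg fun l _ => hnn i j k l).1 h2 j
      (Finset.mem_univ j)
  have h4 := (Finset.sum_eq_zero_iff_of_nonneg fun k _ => Finset.sum_nonneg fun l _ =>
    hnn i j k l).1 h3 k (Finset.mem_univ k)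
  have h5 := (Finset.sum_eq_zero_iff_of_nonneg fun l _ => hnn i j k l).1 h4 l
    (Finset.mem_univ l)
  rw [if_pos h] at h5
  by_contra hne
  have hQ := hr.2 i j k l h
  have := dirichletForm_pos (inv_pos.2 (hr.1 i)) (inv_pos.2 (hr.1 j)) (inv_pos.2 (hr.1 k))
    (inv_pos.2 (hr.1 l)) (descartesQ_eq (r i) (r j) (r k) (r l) ▸ hQ) hne
  have h6 := mul_pos (one_div_pos.2 (Real.sqrt_pos.2 hQ)) this
  linarith

end BallPacking

namespace BallPacking

/-! ### Regularity of the extended curvature, and its behaviour along segments -/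

lemma continuousAt_bendAngle {x y z w : ℝ} (he : 0 < faceE x y z) :
    ContinuousAt (fun p : ℝ × ℝ × ℝ × ℝ => bendAngle p.1 p.2.1 p.2.2.1 p.2.2.2) (x, y, z, w) := by
  unfold bendAngle
  refine Real.continuous_arcsin.continuousAt.comp (ContinuousAt.div (by fun_prop) ?_ ?_)
  · unfold faceE
    fun_prop
  · have := Real.sqrt_pos.2 he
    positivity

lemma contDiffAt_bendAngle {x y z w : ℝ} (he : 0 < faceE x y z) (hQ : bendQ x y z w ≠ 0) :
    ContDiffAt ℝ 1 (fun p : ℝ × ℝ × ℝ × ℝ => bendAngle p.1 p.2.1 p.2.2.1 p.2.2.2)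
      (x, y, z, w) := by
  unfold bendAngle
  have h1 := one_sub_sq_bend w he
  have hne : bendQ x y z w / (4 * faceE x y z) ≠ 0 := by positivity
  have hpos := Real.sqrt_pos.2 he
  have hE : ContDiffAt ℝ 1 (fun p : ℝ × ℝ × ℝ × ℝ => faceE p.1 p.2.1 p.2.2.1) (x, y, z, w) := by
    unfold faceE
    fun_prop
  refine ContDiffAt.comp (x, y, z, w) (g := Real.arcsin) (Real.contDiffAt_arcsin ?_ ?_)
    (ContDiffAt.div (by fun_prop) (contDiffAt_const.mul (hE.sqrt he.ne')) (by positivity))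
  · intro h; simp only at h; rw [h] at h1; norm_num at h1; exact hne h1.symm
  · intro h; simp only at h; rw [h] at h1; norm_num at h1; exact hne h1.symm

lemma abs_bendSolidAngle_le (x y z w : ℝ) : |bendSolidAngle x y z w| ≤ 4 * Real.pi := by
  have h : ∀ x y z w, -(Real.pi / 2) ≤ bendAngle x y z w ∧ bendAngle x y z w ≤ Real.pi / 2 :=
    fun _ _ _ _ => ⟨Real.neg_pi_div_two_le_arcsin _, Real.arcsin_le_pi_div_two _⟩
  have h1 := h x y z w
  have h2 := h x y w z
  have h3 := h x z w y
  unfold bendSolidAngle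
  rw [abs_le]
  constructor <;> linarith

lemma bendAngle_smul {c : ℝ} (hc : 0 < c) (x y z w : ℝ) :
    bendAngle (c * x) (c * y) (c * z) (c * w) = bendAngle x y z w := by
  have h : faceE (c * x) (c * y) (c * z) = c ^ 2 * faceE x y z := by unfold faceE; ring
  unfold bendAngle
  rw [h, Real.sqrt_mul (by positivity), Real.sqrt_sq hc.le]
  congr 1
  rw [show c * x + c * y + c * z - c * w = c * (x + y + z - w) by ring,
    show 2 * (c * √(faceE x y z)) = c * (2 * √(faceE x y z)) by ring,
    mul_div_mul_left _ _ hc.ne']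

lemma bendSolidAngle_smul {c : ℝ} (hc : 0 < c) (x y z w : ℝ) :
    bendSolidAngle (c * x) (c * y) (c * z) (c * w) = bendSolidAngle x y z w := by
  unfold bendSolidAngle
  simp only [bendAngle_smul hc]

lemma descartesQ_smul (c a b d e : ℝ) :
    descartesQ (c * a) (c * b) (c * d) (c * e) = (c⁻¹) ^ 2 * descartesQ a b d e := by
  rw [descartesQ_eq, descartesQ_eq]
  unfold bendQ
  simp only [mul_inv]
  ring

variable {V : Type*} [DecidableEq V] {T : AbstractSimplicialComplex V}

lemma smul_mem_packings {r : V → ℝ} (hr : r ∈ packings T) {c : ℝ} (hc : 0 < c) :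
    c • r ∈ packings T := by
  refine ⟨fun i => mul_pos hc (hr.1 i), fun i j k l h => ?_⟩
  simp only [Pi.smul_apply, smul_eq_mul, descartesQ_smul]
  exact mul_pos (by positivity) (hr.2 i j k l h)

/-- Multiplied by the squared product of the radii, `Q` becomes a polynomial in `t` that does not
vanish at `0`. Thus differentiability of the extended curvature fails at only finitely many points
of a line through a packing. -/
lemma finite_zeros_descartesQ {a b c d : ℝ} (hQ : descartesQ a b c d ≠ 0) (ha : a ≠ 0)
    (hb : b ≠ 0) (hc : c ≠ 0) (hd : d ≠ 0) (a' b' c' d' : ℝ) :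
    {t : ℝ | (a + t * a' ≠ 0 ∧ b + t * b' ≠ 0 ∧ c + t * c' ≠ 0 ∧ d + t * d' ≠ 0) ∧
      descartesQ (a + t * a') (b + t * b') (c + t * c') (d + t * d') = 0}.Finite := by
  let A : Polynomial ℝ := .C a + .X * .C a'
  let B : Polynomial ℝ := .C b + .X * .C b'
  let D : Polynomial ℝ := .C c + .X * .C c'
  let E : Polynomial ℝ := .C d + .X * .C d'
  let P : Polynomial ℝ := (B * D * E + A * D * E + A * B * E + A * B * D) ^ 2 -
    2 * ((B * D * E) ^ 2 + (A * D * E) ^ 2 + (A * B * E) ^ 2 + (A * B * D) ^ 2)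
  have key : ∀ a b c d : ℝ, a ≠ 0 → b ≠ 0 → c ≠ 0 → d ≠ 0 →
      (b * c * d + a * c * d + a * b * d + a * b * c) ^ 2 -
        2 * ((b * c * d) ^ 2 + (a * c * d) ^ 2 + (a * b * d) ^ 2 + (a * b * c) ^ 2) =
      (a * b * c * d) ^ 2 * descartesQ a b c d := by
    intro a b c d ha hb hc hd
    unfold descartesQ
    field_simp
  have hP (t : ℝ) : P.eval t =
      ((b + t * b') * (c + t * c') * (d + t * d') + (a + t * a') * (c + t * c') * (d + t * d') +
        (a + t * a') * (b + t * b') * (d + t * d') +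
        (a + t * a') * (b + t * b') * (c + t * c')) ^ 2 -
      2 * (((b + t * b') * (c + t * c') * (d + t * d')) ^ 2 +
        ((a + t * a') * (c + t * c') * (d + t * d')) ^ 2 +
        ((a + t * a') * (b + t * b') * (d + t * d')) ^ 2 +
        ((a + t * a') * (b + t * b') * (c + t * c')) ^ 2) := by
    simp [P, A, B, D, E, mul_comm t]
  have hP0 : P ≠ 0 := by
    intro h
    have h1 := hP 0
    simp only [zero_mul, add_zero] at h1
    rw [key a b c d ha hb hc hd, h] at h1
    have : (a * b * c * d) ^ 2 * descartesQ a b c d ≠ 0 := by positivity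
    exact this (by simpa using h1.symm)
  refine (Polynomial.finite_setOfPred_isRoot hP0).subset ?_
  rintro t ⟨⟨h1, h2, h3, h4⟩, h5⟩
  simp only [mem_ofPred_eq, Polynomial.IsRoot]
  rw [hP, key _ _ _ _ h1 h2 h3 h4, h5, mul_zero]

/-- A continuous function with nonnegative derivative off a finite set is monotone. -/
lemma monotoneOn_of_hasDerivAt_nonneg_off_finite {f f' : ℝ → ℝ} {Z : Set ℝ} (hZ : Z.Finite)
    {a b : ℝ} (hf : ContinuousOn f (Icc a b))
    (hf' : ∀ t ∈ Ioo a b, t ∉ Z → HasDerivAt f (f' t) t)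
    (h0 : ∀ t ∈ Ioo a b, t ∉ Z → 0 ≤ f' t) : MonotoneOn f (Icc a b) := by
  induction Z, hZ using Set.Finite.induction_on generalizing a b with
  | empty =>
    refine monotoneOn_of_deriv_nonneg (convex_Icc a b) hf ?_ ?_ <;> rw [interior_Icc]
    · exact fun t ht => (hf' t ht (by simp)).differentiableAt.differentiableWithinAt
    · intro t ht
      rw [(hf' t ht (by simp)).deriv]
      exact h0 t ht (by simp)
  | @insert z Z _ _ ih =>
    by_cases hz : z ∈ Ioo a b
    · have h1 : MonotoneOn f (Icc a z) := by
        refine ih (hf.mono (Icc_subset_Icc_right hz.2.le)) ?_ ?_ <;>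
        · intro t ht htZ
          have hne : t ∉ insert z Z := by
            rintro (h | h)
            · exact ht.2.ne h
            · exact htZ h
          first
            | exact hf' t ⟨ht.1, ht.2.trans hz.2⟩ hne
            | exact h0 t ⟨ht.1, ht.2.trans hz.2⟩ hne
      have h2 : MonotoneOn f (Icc z b) := by
        refine ih (hf.mono (Icc_subset_Icc_left hz.1.le)) ?_ ?_ <;>
        · intro t ht htZ
          have hne : t ∉ insert z Z := by
            rintro (h | h)
            · exact ht.1.ne' h
            · exact htZ h
          first
            | exact hf' t ⟨hz.1.trans ht.1, ht.2⟩ hne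
            | exact h0 t ⟨hz.1.trans ht.1, ht.2⟩ hne
      rw [← Icc_union_Icc_eq_Icc hz.1.le hz.2.le]
      exact h1.union_right h2 (isGreatest_Icc hz.1.le) (isLeast_Icc hz.2.le)
    · refine ih hf ?_ ?_ <;>
      · intro t ht htZ
        have hne : t ∉ insert z Z := by
          rintro (h | h)
          · exact hz (h ▸ ht)
          · exact htZ h
        first
          | exact hf' t ht hne
          | exact h0 t ht hne

variable [Fintype V]

lemma continuousAt_extCurvature {r : V → ℝ} (hr : ∀ i, 0 < r i) (i : V) :
    ContinuousAt (fun p => extCurvature T p i) r := by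
  unfold extCurvature
  have hc : ∀ i, ContinuousAt (fun p : V → ℝ => (p i)⁻¹) r := fun i =>
    (continuous_apply i).continuousAt.inv₀ (hr i).ne'
  have hb : ∀ a b c d : V, ContinuousAt
      (fun p : V → ℝ => bendAngle (p a)⁻¹ (p b)⁻¹ (p c)⁻¹ (p d)⁻¹) r := fun a b c d =>
    ContinuousAt.comp (x := r) (f := fun p : V → ℝ => ((p a)⁻¹, (p b)⁻¹, (p c)⁻¹, (p d)⁻¹))
      (g := fun q : ℝ × ℝ × ℝ × ℝ => bendAngle q.1 q.2.1 q.2.2.1 q.2.2.2)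
      (continuousAt_bendAngle (faceE_pos (inv_pos.2 (hr a)) (inv_pos.2 (hr b)) (inv_pos.2 (hr c))))
      ((hc a).prodMk ((hc b).prodMk ((hc c).prodMk (hc d))))
  refine continuousAt_const.sub (continuousAt_const.mul (tendsto_finsetSum _ fun j _ =>
    tendsto_finsetSum _ fun k _ => tendsto_finsetSum _ fun l _ => ?_))
  split_ifs with h
  · exact (continuousAt_const.mul (((hb _ _ _ _).add (hb _ _ _ _)).add (hb _ _ _ _))).sub
      continuousAt_const
  · exact tendsto_const_nhds

lemma contDiffAt_extCurvature {r : V → ℝ} (hr : r ∈ packings T) (i : V) :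
    ContDiffAt ℝ 1 (fun p => extCurvature T p i) r := by
  unfold extCurvature
  have hc : ∀ i, ContDiffAt ℝ 1 (fun p : V → ℝ => (p i)⁻¹) r := fun i =>
    (contDiffAt_apply ℝ ℝ i r).inv (hr.1 i).ne'
  have hb : ∀ a b c d : V, bendQ (r a)⁻¹ (r b)⁻¹ (r c)⁻¹ (r d)⁻¹ ≠ 0 → ContDiffAt ℝ 1
      (fun p : V → ℝ => bendAngle (p a)⁻¹ (p b)⁻¹ (p c)⁻¹ (p d)⁻¹) r := fun a b c d hQ =>
    ContDiffAt.comp r (f := fun p : V → ℝ => ((p a)⁻¹, (p b)⁻¹, (p c)⁻¹, (p d)⁻¹))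
      (g := fun q : ℝ × ℝ × ℝ × ℝ => bendAngle q.1 q.2.1 q.2.2.1 q.2.2.2)
      (contDiffAt_bendAngle
        (faceE_pos (inv_pos.2 (hr.1 a)) (inv_pos.2 (hr.1 b)) (inv_pos.2 (hr.1 c))) hQ)
      ((hc a).prodMk ((hc b).prodMk ((hc c).prodMk (hc d))))
  refine contDiffAt_const.sub (contDiffAt_const.mul (ContDiffAt.sum fun j _ =>
    ContDiffAt.sum fun k _ => ContDiffAt.sum fun l _ => ?_))
  split_ifs with h
  · have hQ := (descartesQ_eq _ _ _ _ ▸ (hr.2 i j k l h).ne' :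
      bendQ (r i)⁻¹ (r j)⁻¹ (r k)⁻¹ (r l)⁻¹ ≠ 0)
    have q1 : bendQ (r i)⁻¹ (r j)⁻¹ (r l)⁻¹ (r k)⁻¹ ≠ 0 := by
      convert hQ using 1; unfold bendQ; ring
    have q2 : bendQ (r i)⁻¹ (r k)⁻¹ (r l)⁻¹ (r j)⁻¹ ≠ 0 := by
      convert hQ using 1; unfold bendQ; ring
    exact (contDiffAt_const.mul (((hb _ _ _ _ hQ).add (hb _ _ _ _ q1)).add (hb _ _ _ _ q2))).sub
      contDiffAt_const
  · exact contDiffAt_const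

/-- Bounds the slope of the total curvature in unit directions; this is the Lipschitz constant in
`exists_lower_bound`. -/
lemma exists_abs_extCurvature_le (T : AbstractSimplicialComplex V) :
    ∃ B : ℝ, 0 < B ∧ ∀ r i, |extCurvature T r i| ≤ B := by
  refine ⟨4 * Real.pi + 1 / 6 * ∑ _j : V, ∑ _k : V, ∑ _l : V, 4 * Real.pi,
    by positivity, fun r i => ?_⟩
  unfold extCurvature
  refine (abs_sub _ _).trans (add_le_add (abs_of_pos (by positivity)).le ?_)
  rw [abs_mul, abs_of_pos (by norm_num : (0 : ℝ) < 1 / 6)]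
  refine mul_le_mul_of_nonneg_left ?_ (by norm_num)
  refine (Finset.abs_sum_le_sum_abs _ _).trans (Finset.sum_le_sum fun j _ => ?_)
  refine (Finset.abs_sum_le_sum_abs _ _).trans (Finset.sum_le_sum fun k _ => ?_)
  refine (Finset.abs_sum_le_sum_abs _ _).trans (Finset.sum_le_sum fun l _ => ?_)
  split_ifs
  · exact abs_bendSolidAngle_le _ _ _ _
  · simp [Real.pi_pos.le]

/-- The curvature at `i` does not change under a scaling of each tetrahedron at `i`. -/
lemma extCurvature_congr_scale {r p : V → ℝ} (i : V) (h : ∀ j k l, IsTetrahedron T i j k l →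
    ∃ c > 0, p i = c * r i ∧ p j = c * r j ∧ p k = c * r k ∧ p l = c * r l) :
    extCurvature T p i = extCurvature T r i := by
  unfold extCurvature
  congr 2
  refine Finset.sum_congr rfl fun j _ => Finset.sum_congr rfl fun k _ =>
    Finset.sum_congr rfl fun l _ => ?_
  split_ifs with ht
  · obtain ⟨c, hc, h1, h2, h3, h4⟩ := h j k l ht
    rw [h1, h2, h3, h4, mul_inv, mul_inv, mul_inv, mul_inv, bendSolidAngle_smul (inv_pos.2 hc)]
  · rfl

lemma extCurvature_smul (r : V → ℝ) {c : ℝ} (hc : 0 < c) (i : V) :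
    extCurvature T (c • r) i = extCurvature T r i :=
  extCurvature_congr_scale i fun _ _ _ _ => ⟨c, hc, rfl, rfl, rfl, rfl⟩

lemma isOpen_packings (T : AbstractSimplicialComplex V) : IsOpen (packings T) := by
  rw [isOpen_iff_mem_nhds]
  intro r hr
  have h1 : ∀ᶠ p : V → ℝ in nhds r, ∀ i, 0 < p i := Filter.eventually_all.2 fun i =>
    (continuous_apply i).continuousAt.eventually_const_lt (hr.1 i)
  have h2 : ∀ᶠ p : V → ℝ in nhds r, ∀ i j k l, IsTetrahedron T i j k l →
      0 < descartesQ (p i) (p j) (p k) (p l) := by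
    refine Filter.eventually_all.2 fun i => Filter.eventually_all.2 fun j =>
      Filter.eventually_all.2 fun k => Filter.eventually_all.2 fun l => ?_
    by_cases h : IsTetrahedron T i j k l
    · have hc : ∀ i, ContinuousAt (fun p : V → ℝ => 1 / p i) r := fun i =>
        continuousAt_const.div (continuous_apply i).continuousAt (hr.1 i).ne'
      have hc2 : ∀ i, ContinuousAt (fun p : V → ℝ => 1 / p i ^ 2) r := fun i =>
        continuousAt_const.div ((continuous_apply i).continuousAt.pow 2)
          (pow_ne_zero 2 (hr.1 i).ne')
      have : ContinuousAt (fun p : V → ℝ => descartesQ (p i) (p j) (p k) (p l)) r := by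
        unfold descartesQ
        exact (((((hc i).add (hc j)).add (hc k)).add (hc l)).pow 2).sub
          (continuousAt_const.mul ((((hc2 i).add (hc2 j)).add (hc2 k)).add (hc2 l)))
      filter_upwards [this.eventually_const_lt (hr.2 i j k l h)] with p hp _ using hp
    · exact Filter.Eventually.of_forall fun p hp => absurd hp h
  filter_upwards [h1, h2] with p hp1 hp2 using ⟨hp1, hp2⟩

end BallPacking

namespace BallPacking

/-! ### The total curvature: gradient and convexity along segments. -/

variable {V : Type*} [Fintype V] [DecidableEq V] {T : AbstractSimplicialComplex V}

/-- The total curvature `∑ i, K i * r i` for the extended curvature. -/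
def totalCurvature (T : AbstractSimplicialComplex V) (r : V → ℝ) : ℝ :=
  ∑ i, extCurvature T r i * r i

/-- The derivative of the total curvature along the line through `r` with direction `η`. -/
def lineDerivTotal (T : AbstractSimplicialComplex V) (r η : V → ℝ) (t : ℝ) : ℝ :=
  ∑ i, extCurvature T (r + t • η) i * η i

lemma avgCurvature_eq {r : V → ℝ} (hr : r ∈ packings T) :
    avgCurvature T r = totalCurvature T r / ∑ i, r i := by
  unfold avgCurvature totalCurvature
  simp only [extCurvature_eq hr]

lemma continuousAt_totalCurvature {r : V → ℝ} (hr : ∀ i, 0 < r i) :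
    ContinuousAt (totalCurvature T) r :=
  tendsto_finsetSum _ fun i _ =>
    (continuousAt_extCurvature hr i).mul (continuous_apply i).continuousAt

/-- The terms with derivatives of the curvature cancel by Schläfli's formula. -/
lemma hasDerivAt_totalCurvature {r : ℝ → V → ℝ} {r' : V → ℝ} {t : ℝ}
    (hr : ∀ i, HasDerivAt (fun s => r s i) (r' i) t) (hpos : ∀ i, 0 < r t i)
    (hQ : ∀ i j k l, IsTetrahedron T i j k l →
      descartesQ (r t i) (r t j) (r t k) (r t l) ≠ 0) :
    HasDerivAt (fun s => totalCurvature T (r s)) (∑ i, extCurvature T (r t) i * r' i) t := by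
  refine (HasDerivAt.fun_sum fun i _ =>
    (hasDerivAt_extCurvature hr hpos hQ i).mul (hr i)).congr_deriv ?_
  rw [Finset.sum_add_distrib]
  have := sum_mul_curvatureDeriv (T := T) (fun i => (hpos i).ne') r'
  simp only [mul_comm (curvatureDeriv T (r t) r' _), this, zero_add]

lemma hasDerivAt_line (r η : V → ℝ) (t : ℝ) (i : V) :
    HasDerivAt (fun s : ℝ => (r + s • η) i) (η i) t := by
  simpa using ((hasDerivAt_id t).mul_const (η i)).const_add (r i)

lemma hasDerivAt_lineDerivTotal {r η : V → ℝ} {t : ℝ} (hpos : ∀ i, 0 < (r + t • η) i)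
    (hQ : ∀ i j k l, IsTetrahedron T i j k l →
      descartesQ ((r + t • η) i) ((r + t • η) j) ((r + t • η) k) ((r + t • η) l) ≠ 0) :
    HasDerivAt (lineDerivTotal T r η) (∑ i, η i * curvatureDeriv T (r + t • η) η i) t := by
  refine (HasDerivAt.fun_sum fun i _ => (hasDerivAt_extCurvature (r := fun s => r + s • η)
    (hasDerivAt_line r η t) hpos hQ i).mul_const (η i)).congr_deriv ?_
  exact Finset.sum_congr rfl fun i _ => mul_comm _ _

/-- Along a line through a ball packing, all but finitely many points are nondegenerate. -/
lemma exists_finite_degenerate {r : V → ℝ} (hr : r ∈ packings T) (η : V → ℝ) :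
    ∃ Z : Set ℝ, Z.Finite ∧ ∀ t ∉ Z, (∀ i, 0 < (r + t • η) i) →
      ∀ i j k l, IsTetrahedron T i j k l →
      descartesQ ((r + t • η) i) ((r + t • η) j) ((r + t • η) k) ((r + t • η) l) ≠ 0 := by
  classical
  let Z : V → V → V → V → Set ℝ := fun i j k l => if IsTetrahedron T i j k l then
    {t : ℝ | (r i + t * η i ≠ 0 ∧ r j + t * η j ≠ 0 ∧ r k + t * η k ≠ 0 ∧ r l + t * η l ≠ 0) ∧
      descartesQ (r i + t * η i) (r j + t * η j) (r k + t * η k) (r l + t * η l) = 0} else ∅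
  refine ⟨⋃ i, ⋃ j, ⋃ k, ⋃ l, Z i j k l, finite_iUnion fun i => finite_iUnion fun j =>
    finite_iUnion fun k => finite_iUnion fun l => ?_, ?_⟩
  · simp only [Z]
    split_ifs with h
    · exact finite_zeros_descartesQ (hr.2 i j k l h).ne' (hr.1 i).ne' (hr.1 j).ne' (hr.1 k).ne'
        (hr.1 l).ne' _ _ _ _
    · exact finite_empty
  · intro t ht hpos i j k l h h0
    refine ht (mem_iUnion.2 ⟨i, mem_iUnion.2 ⟨j, mem_iUnion.2 ⟨k, mem_iUnion.2 ⟨l, ?_⟩⟩⟩⟩)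
    simp only [Z, if_pos h]
    exact ⟨⟨(hpos i).ne', (hpos j).ne', (hpos k).ne', (hpos l).ne'⟩, h0⟩

lemma segment_pos {r η : V → ℝ} {τ : ℝ} (hr : ∀ i, 0 < r i) (hτ : ∀ i, 0 < (r + τ • η) i)
    {t : ℝ} (ht : t ∈ Icc 0 τ) (i : V) : 0 < (r + t • η) i := by
  have h1 := hr i
  have h2 := hτ i
  simp only [Pi.add_apply, Pi.smul_apply, smul_eq_mul] at h2 ⊢
  rcases le_or_gt 0 (η i) with h | h
  · have := mul_nonneg ht.1 h
    linarith
  · have := mul_le_mul_of_nonpos_right ht.2 h.le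
    linarith

lemma continuousAt_line (r η : V → ℝ) (t : ℝ) : ContinuousAt (fun s : ℝ => r + s • η) t := by
  fun_prop

/-- The total curvature is convex along segments starting at a ball packing, even if they leave
the space of ball packings. -/
lemma monotoneOn_lineDerivTotal {r η : V → ℝ} {τ : ℝ} (hr : r ∈ packings T)
    (hτ : ∀ i, 0 < (r + τ • η) i) : MonotoneOn (lineDerivTotal T r η) (Icc 0 τ) := by
  obtain ⟨Z, hZ, hZQ⟩ := exists_finite_degenerate hr η
  have hpos : ∀ t ∈ Icc 0 τ, ∀ i, 0 < (r + t • η) i := fun t ht => segment_pos hr.1 hτ ht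
  refine monotoneOn_of_hasDerivAt_nonneg_off_finite hZ (fun t ht => ?_)
    (fun t ht htZ => hasDerivAt_lineDerivTotal (hpos t (Ioo_subset_Icc_self ht))
      (hZQ t htZ (hpos t (Ioo_subset_Icc_self ht))))
    (fun t ht _ => curvatureDeriv_form_nonneg (hpos t (Ioo_subset_Icc_self ht)) η)
  refine ContinuousAt.continuousWithinAt (tendsto_finsetSum _ fun i _ => ?_)
  exact (ContinuousAt.comp (f := fun s : ℝ => r + s • η) (continuousAt_extCurvature (hpos t ht) i)
    (continuousAt_line r η t)).mul continuousAt_const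

lemma continuousOn_total_line {r η : V → ℝ} {τ : ℝ} (hr : ∀ i, 0 < r i)
    (hτ : ∀ i, 0 < (r + τ • η) i) :
    ContinuousOn (fun t : ℝ => totalCurvature T (r + t • η)) (Icc 0 τ) := fun t ht =>
  (ContinuousAt.comp (f := fun s : ℝ => r + s • η)
    (continuousAt_totalCurvature (segment_pos hr hτ ht))
    (continuousAt_line r η t)).continuousWithinAt

/-- An integrated form of bounds on the slope, here and in `monotoneOn_sub_total`; the uses take `φ`
zero, linear or quadratic. -/
lemma monotoneOn_total_sub {r η : V → ℝ} {τ : ℝ} (hr : r ∈ packings T)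
    (hτ : ∀ i, 0 < (r + τ • η) i) {φ φ' : ℝ → ℝ} (hφ : ∀ t, HasDerivAt φ (φ' t) t)
    (hle : ∀ t ∈ Ioo 0 τ, φ' t ≤ lineDerivTotal T r η t) :
    MonotoneOn (fun t => totalCurvature T (r + t • η) - φ t) (Icc 0 τ) := by
  obtain ⟨Z, hZ, hZQ⟩ := exists_finite_degenerate hr η
  have hpos : ∀ t ∈ Icc 0 τ, ∀ i, 0 < (r + t • η) i := fun t ht => segment_pos hr.1 hτ ht
  exact monotoneOn_of_hasDerivAt_nonneg_off_finite hZ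
    ((continuousOn_total_line hr.1 hτ).sub fun t _ => (hφ t).continuousAt.continuousWithinAt)
    (fun t ht htZ => (hasDerivAt_totalCurvature (r := fun s => r + s • η) (hasDerivAt_line r η t)
      (hpos t (Ioo_subset_Icc_self ht))
      (hZQ t htZ (hpos t (Ioo_subset_Icc_self ht)))).sub (hφ t))
    (fun t ht _ => sub_nonneg.2 (hle t ht))

lemma monotoneOn_sub_total {r η : V → ℝ} {τ : ℝ} (hr : r ∈ packings T)
    (hτ : ∀ i, 0 < (r + τ • η) i) {φ φ' : ℝ → ℝ} (hφ : ∀ t, HasDerivAt φ (φ' t) t)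
    (hle : ∀ t ∈ Ioo 0 τ, lineDerivTotal T r η t ≤ φ' t) :
    MonotoneOn (fun t => φ t - totalCurvature T (r + t • η)) (Icc 0 τ) := by
  obtain ⟨Z, hZ, hZQ⟩ := exists_finite_degenerate hr η
  have hpos : ∀ t ∈ Icc 0 τ, ∀ i, 0 < (r + t • η) i := fun t ht => segment_pos hr.1 hτ ht
  exact monotoneOn_of_hasDerivAt_nonneg_off_finite hZ
    (ContinuousOn.sub (fun t _ => (hφ t).continuousAt.continuousWithinAt)
      (continuousOn_total_line hr.1 hτ))
    (fun t ht htZ => (hφ t).sub (hasDerivAt_totalCurvature (r := fun s => r + s • η)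
      (hasDerivAt_line r η t) (hpos t (Ioo_subset_Icc_self ht))
      (hZQ t htZ (hpos t (Ioo_subset_Icc_self ht)))))
    (fun t ht _ => sub_nonneg.2 (hle t ht))

/-! ### Comparison with a ball packing of constant curvature -/

lemma extCurvature_const {r : V → ℝ} (hr : r ∈ packings T) {c : ℝ}
    (hc : ∀ i, curvature T r i = c) (i : V) : extCurvature T r i = c := by
  rw [extCurvature_eq hr, hc]

/-- The slope at `0` is `c * ∑ η = 0`, and convexity makes it increase. -/
lemma lineDerivTotal_nonneg {r η : V → ℝ} {τ : ℝ} (hr : r ∈ packings T) {c : ℝ}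
    (hc : ∀ i, curvature T r i = c) (hη : ∑ i, η i = 0) (hτ : ∀ i, 0 < (r + τ • η) i)
    {t : ℝ} (ht : t ∈ Icc 0 τ) : 0 ≤ lineDerivTotal T r η t := by
  have h0 : lineDerivTotal T r η 0 = 0 := by
    unfold lineDerivTotal
    simp only [zero_smul, add_zero, extCurvature_const hr hc, ← Finset.mul_sum, hη, mul_zero]
  rw [← h0]
  exact monotoneOn_lineDerivTotal hr hτ ⟨le_rfl, ht.1.trans ht.2⟩ ht ht.1

/-- The total curvature increases along rays that start at a ball packing of constant curvature. -/
lemma monotoneOn_total_ray {r η : V → ℝ} {τ : ℝ} (hr : r ∈ packings T) {c : ℝ}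
    (hc : ∀ i, curvature T r i = c) (hη : ∑ i, η i = 0) (hτ : ∀ i, 0 < (r + τ • η) i) :
    MonotoneOn (fun t => totalCurvature T (r + t • η)) (Icc 0 τ) := by
  have := monotoneOn_total_sub hr hτ (φ := fun _ => 0) (fun t => hasDerivAt_const t 0)
    (fun t ht => lineDerivTotal_nonneg hr hc hη hτ (Ioo_subset_Icc_self ht))
  simpa using this

lemma sum_sub_eq_zero {p r : V → ℝ} (h : ∑ i, p i = ∑ i, r i) : ∑ i, (p - r) i = 0 := by
  simp [Finset.sum_sub_distrib, h]

lemma totalCurvature_le_of_const {r p : V → ℝ} (hr : r ∈ packings T) {c : ℝ}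
    (hc : ∀ i, curvature T r i = c) (hp : ∀ i, 0 < p i) (hsum : ∑ i, p i = ∑ i, r i) :
    totalCurvature T r ≤ totalCurvature T p := by
  have hτ : ∀ i, 0 < (r + (1 : ℝ) • (p - r)) i := by simpa using hp
  have := monotoneOn_total_ray hr hc (sum_sub_eq_zero hsum) hτ (left_mem_Icc.2 zero_le_one)
    (right_mem_Icc.2 zero_le_one) zero_le_one
  simpa using this

/-- The gradient inequality for the convex function `totalCurvature`. -/
lemma totalCurvature_sub_le {r p : V → ℝ} (hr : r ∈ packings T) (hp : ∀ i, 0 < p i) :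
    totalCurvature T p - totalCurvature T r ≤ ∑ i, extCurvature T p i * (p i - r i) := by
  have hτ : ∀ i, 0 < (r + (1 : ℝ) • (p - r)) i := by simpa using hp
  have hd : ∀ t : ℝ, HasDerivAt (fun t => t * lineDerivTotal T r (p - r) 1)
      (1 * lineDerivTotal T r (p - r) 1) t := fun t => (hasDerivAt_id t).mul_const _
  have := monotoneOn_sub_total hr hτ hd
    (fun t ht => by
      rw [one_mul]
      exact monotoneOn_lineDerivTotal hr hτ (Ioo_subset_Icc_self ht)
        (right_mem_Icc.2 zero_le_one) ht.2.le)
    (left_mem_Icc.2 zero_le_one) (right_mem_Icc.2 zero_le_one) zero_le_one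
  simp [lineDerivTotal] at this
  linarith

/-- A ball packing with the least total curvature has constant curvature. -/
lemma isConstantCurvature_of_total_le {r p : V → ℝ} (hr : r ∈ packings T) {c : ℝ}
    (hc : ∀ i, curvature T r i = c) (hp : p ∈ packings T) (hsum : ∑ i, p i = ∑ i, r i)
    (hle : totalCurvature T p ≤ totalCurvature T r) : IsConstantCurvaturePacking T p := by
  refine ⟨hp, ?_⟩
  have key : ∀ i j, extCurvature T p i = extCurvature T p j := by
    intro i j
    -- This direction preserves the sum of the radii, and the slope of the total curvature along it
    -- is `K_i - K_j`.
    set η : V → ℝ := Pi.single i 1 - Pi.single j 1 with hη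
    have hη0 : ∑ i, η i = 0 := by simp [hη, Finset.sum_sub_distrib]
    have hd := hasDerivAt_totalCurvature (T := T) (r := fun s : ℝ => p + s • η) (t := 0)
      (hasDerivAt_line p η 0) (by simpa using hp.1)
      (by simpa using fun i j k l h => (hp.2 i j k l h).ne')
    have hmin : IsLocalMin (fun s : ℝ => totalCurvature T (p + s • η)) 0 := by
      have : ∀ᶠ s : ℝ in nhds 0, ∀ i, 0 < (p + s • η) i := by
        refine Filter.eventually_all.2 fun i => ?_
        exact (hasDerivAt_line p η 0 i).continuousAt.eventually_const_lt (by simpa using hp.1 i)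
      filter_upwards [this] with s hs
      simp only [zero_smul, add_zero]
      refine hle.trans (totalCurvature_le_of_const hr hc hs ?_)
      simp only [Pi.add_apply, Pi.smul_apply, smul_eq_mul, Finset.sum_add_distrib,
        ← Finset.mul_sum, hη0, mul_zero, add_zero, hsum]
    have h0 := hmin.hasDerivAt_eq_zero hd
    simp only [zero_smul, add_zero, hη, Pi.sub_apply, mul_sub, Finset.sum_sub_distrib] at h0
    simp only [Pi.single_apply, mul_ite, mul_one, mul_zero, Finset.sum_ite_eq', Finset.mem_univ,
      if_true] at h0
    linarith
  rcases isEmpty_or_nonempty V with hV | ⟨⟨j⟩⟩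
  · exact ⟨0, fun i => (hV.false i).elim⟩
  · exact ⟨extCurvature T p j, fun i => by rw [← extCurvature_eq hp, key i j]⟩

lemma norm_sub_le_sum {p r : V → ℝ} (hp : ∀ i, 0 < p i) (hr : ∀ i, 0 < r i)
    (hsum : ∑ i, p i = ∑ i, r i) : ‖p - r‖ ≤ ∑ i, r i := by
  refine (pi_norm_le_iff_of_nonneg (Finset.sum_nonneg fun i _ => (hr i).le)).2 fun i => ?_
  have h1 := Finset.single_le_sum (f := r) (fun i _ => (hr i).le) (Finset.mem_univ i)
  have h2 := Finset.single_le_sum (f := p) (fun i _ => (hp i).le) (Finset.mem_univ i)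
  have := hp i
  have := hr i
  rw [Pi.sub_apply, Real.norm_eq_abs, abs_le]
  constructor <;> linarith

/-! ### From definiteness at one packing to global quadratic growth. -/

lemma curvatureDeriv_eq_fderiv {r : V → ℝ} (hr : r ∈ packings T) (η : V → ℝ) (i : V) :
    fderiv ℝ (fun p => extCurvature T p i) r η = curvatureDeriv T r η i := by
  have hd := ((contDiffAt_extCurvature hr i).differentiableAt one_ne_zero).hasFDerivAt
  have h0 : r + (0 : ℝ) • η = r := by simp
  have h1 : HasDerivAt (fun s : ℝ => r + s • η) η 0 :=
    hasDerivAt_pi.2 fun i => hasDerivAt_line r η 0 i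
  have h2 := (h0 ▸ hd : HasFDerivAt (fun p => extCurvature T p i) _
    (r + (0 : ℝ) • η)).comp_hasDerivAt (0 : ℝ) h1
  have h3 := hasDerivAt_extCurvature (T := T) (r := fun s : ℝ => r + s • η) (t := 0)
    (hasDerivAt_line r η 0) (by simpa using hr.1)
    (by simpa using fun i j k l h => (hr.2 i j k l h).ne') i
  rw [h0] at h2
  simp only [zero_smul, add_zero] at h3
  exact h2.unique h3

/-- Compactness of the unit sphere of the hyperplane, then homogeneity of degree two. -/
lemma exists_form_ge {r : V → ℝ} (hr : r ∈ packings T)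
    (hker : ∀ η : V → ℝ, ∑ i, η i = 0 → ∑ i, η i * curvatureDeriv T r η i = 0 → η = 0) :
    ∃ m > 0, ∀ η : V → ℝ, ∑ i, η i = 0 →
      m * ‖η‖ ^ 2 ≤ ∑ i, η i * curvatureDeriv T r η i := by
  let K : Set (V → ℝ) := Metric.sphere 0 1 ∩ {η | ∑ i, η i = 0}
  have hK : IsCompact K := (isCompact_sphere 0 1).inter_right
    (isClosed_eq (by fun_prop) continuous_const)
  have hcont : ContinuousOn (fun η => ∑ i, η i * curvatureDeriv T r η i) K := by
    simp only [← curvatureDeriv_eq_fderiv hr]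
    fun_prop
  obtain ⟨m, hm, hmK⟩ := hK.exists_forall_le' hcont (a := 0) fun η hη => by
    refine lt_of_le_of_ne (curvatureDeriv_form_nonneg hr.1 η) fun h => ?_
    have h1 := hη.1
    rw [hker η hη.2 h.symm] at h1
    simp at h1
  refine ⟨m, hm, fun η hη => ?_⟩
  by_cases h0 : η = 0
  · simp [h0]
  have hn : 0 < ‖η‖ := norm_pos_iff.2 h0
  have h1 := hmK (‖η‖⁻¹ • η) ⟨by simp [norm_smul, hn.ne'], by
    simp only [mem_ofPred_eq, Pi.smul_apply, smul_eq_mul, ← Finset.mul_sum, hη, mul_zero]⟩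
  have h2 : ∑ i, (‖η‖⁻¹ • η) i * curvatureDeriv T r (‖η‖⁻¹ • η) i =
      (‖η‖⁻¹) ^ 2 * ∑ i, η i * curvatureDeriv T r η i := by
    rw [Finset.mul_sum]
    refine Finset.sum_congr rfl fun i _ => ?_
    rw [← curvatureDeriv_eq_fderiv hr, ← curvatureDeriv_eq_fderiv hr, map_smul]
    simp only [Pi.smul_apply, smul_eq_mul]
    ring
  rw [h2, inv_pow, ← div_eq_inv_mul, le_div_iff₀ (by positivity)] at h1
  exact h1

lemma exists_local_strong_monotone {r : V → ℝ} (hr : r ∈ packings T) {c : ℝ}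
    (hc : ∀ i, curvature T r i = c)
    (hker : ∀ η : V → ℝ, ∑ i, η i = 0 → ∑ i, η i * curvatureDeriv T r η i = 0 → η = 0) :
    ∃ m > 0, ∃ δ > 0, ∀ η : V → ℝ, ‖η‖ < δ → ∑ i, η i = 0 →
      m * ‖η‖ ^ 2 ≤ ∑ i, extCurvature T (r + η) i * η i := by
  obtain ⟨m, hm, hform⟩ := exists_form_ge hr hker
  -- Chosen so that the linearization errors, summed over all vertices, cost at most half of `m`;
  -- the constant `c` drops out because `η` has sum zero.
  set ε := m / (2 * (Fintype.card V + 1)) with hε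
  have hε0 : 0 < ε := by positivity
  have h1 : ∀ᶠ η : V → ℝ in nhds 0, ∀ i,
      |extCurvature T (r + η) i - c - curvatureDeriv T r η i| ≤ ε * ‖η‖ := by
    refine Filter.eventually_all.2 fun i => ?_
    have hd := ((contDiffAt_extCurvature hr i).differentiableAt one_ne_zero).hasFDerivAt
    have := (hasFDerivAt_iff_isLittleO_nhds_zero.1 hd).bound hε0
    simpa only [curvatureDeriv_eq_fderiv hr, extCurvature_const hr hc, Real.norm_eq_abs] using this
  obtain ⟨δ, hδ, hball⟩ := Metric.eventually_nhds_iff.1 h1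
  refine ⟨m / 2, by positivity, δ, hδ, fun η hη hsum => ?_⟩
  have h2 := hball (by simpa using hη : dist η 0 < δ)
  have h3 : ∑ i, extCurvature T (r + η) i * η i = ∑ i, η i * curvatureDeriv T r η i +
      ∑ i, (extCurvature T (r + η) i - c - curvatureDeriv T r η i) * η i := by
    rw [← Finset.sum_add_distrib, ← sub_eq_zero, ← Finset.sum_sub_distrib]
    rw [Finset.sum_congr rfl fun i _ => (by ring : _ = c * η i), ← Finset.mul_sum, hsum, mul_zero]
  have h4 : |∑ i, (extCurvature T (r + η) i - c - curvatureDeriv T r η i) * η i| ≤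
      Fintype.card V * (ε * ‖η‖ ^ 2) := by
    refine (Finset.abs_sum_le_sum_abs _ _).trans ?_
    rw [← nsmul_eq_mul, ← Finset.card_univ]
    refine Finset.sum_le_card_nsmul _ _ _ fun i _ => ?_
    rw [abs_mul, pow_two, ← mul_assoc]
    exact mul_le_mul (h2 i) (norm_le_pi_norm η i) (abs_nonneg _) (by positivity)
  have h5 : Fintype.card V * (ε * ‖η‖ ^ 2) ≤ m / 2 * ‖η‖ ^ 2 := by
    rw [← mul_assoc]
    refine mul_le_mul_of_nonneg_right ?_ (by positivity)
    rw [hε, mul_div_assoc', div_le_div_iff₀ (by positivity) (by positivity)]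
    nlinarith
  have h6 := hform η hsum
  have h7 := neg_abs_le (∑ i, (extCurvature T (r + η) i - c - curvatureDeriv T r η i) * η i)
  rw [h3]
  linarith

/-- If the derivative of the curvature at `r` is definite, the curvature is strongly monotone. -/
lemma exists_strong_monotone {r : V → ℝ} (hr : r ∈ packings T) {c : ℝ}
    (hc : ∀ i, curvature T r i = c)
    (hker : ∀ η : V → ℝ, ∑ i, η i = 0 → ∑ i, η i * curvatureDeriv T r η i = 0 → η = 0) :
    ∃ m > 0, ∀ p : V → ℝ, (∀ i, 0 < p i) → ∑ i, p i = ∑ i, r i →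
      m * ‖p - r‖ ^ 2 ≤ ∑ i, extCurvature T p i * (p i - r i) := by
  obtain ⟨m, hm, δ, hδ, hloc⟩ := exists_local_strong_monotone hr hc hker
  set D := ∑ i, r i
  have hD : 0 ≤ D := Finset.sum_nonneg fun i _ => (hr.1 i).le
  -- Since `‖p - r‖ ≤ D`, this factor brings every `p - r` into the `δ`-ball. The slope bound
  -- obtained at `t` then passes to the far end of the segment by convexity.
  set t := min 1 (δ / (2 * D + 1))
  have ht0 : 0 < t := lt_min one_pos (by positivity)
  refine ⟨m * t, by positivity, fun p hp hsum => ?_⟩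
  have hτ : ∀ i, 0 < (r + (1 : ℝ) • (p - r)) i := by simpa using hp
  have ht : t ∈ Icc (0 : ℝ) 1 := ⟨ht0.le, min_le_left _ _⟩
  have hn := norm_sub_le_sum hp hr.1 hsum
  have h1 := hloc (t • (p - r)) (by
      rw [norm_smul, Real.norm_eq_abs, abs_of_pos ht0]
      calc t * ‖p - r‖ ≤ δ / (2 * D + 1) * D :=
            mul_le_mul (min_le_right _ _) hn (norm_nonneg _) (by positivity)
        _ < δ := by
            rw [div_mul_eq_mul_div, div_lt_iff₀ (by positivity)]
            nlinarith)
    (by simp only [Pi.smul_apply, smul_eq_mul, ← Finset.mul_sum, sum_sub_eq_zero hsum, mul_zero])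
  have h2 : ∑ i, extCurvature T (r + t • (p - r)) i * (t • (p - r)) i =
      t * lineDerivTotal T r (p - r) t := by
    unfold lineDerivTotal
    rw [Finset.mul_sum]
    refine Finset.sum_congr rfl fun i _ => ?_
    simp only [Pi.smul_apply, smul_eq_mul]
    ring
  rw [h2, norm_smul, mul_pow, Real.norm_eq_abs, sq_abs] at h1
  have h3 : m * t * ‖p - r‖ ^ 2 ≤ lineDerivTotal T r (p - r) t := by
    refine le_of_mul_le_mul_left ?_ ht0
    linarith
  refine h3.trans ((monotoneOn_lineDerivTotal hr hτ ht (right_mem_Icc.2 zero_le_one) ht.2).trans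
    (le_of_eq ?_))
  simp [lineDerivTotal]

/-- Strong monotonicity makes the slope at time `t` of the segment at least `m * ‖p - r‖ ^ 2 * t`;
integrate. -/
lemma exists_quadratic_growth {r : V → ℝ} (hr : r ∈ packings T) {c : ℝ}
    (hc : ∀ i, curvature T r i = c)
    (hker : ∀ η : V → ℝ, ∑ i, η i = 0 → ∑ i, η i * curvatureDeriv T r η i = 0 → η = 0) :
    ∃ m > 0, ∀ p : V → ℝ, (∀ i, 0 < p i) → ∑ i, p i = ∑ i, r i →
      m * ‖p - r‖ ^ 2 ≤ totalCurvature T p - totalCurvature T r := by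
  obtain ⟨m, hm, h⟩ := exists_strong_monotone hr hc hker
  refine ⟨m / 2, by positivity, fun p hp hsum => ?_⟩
  have hτ : ∀ i, 0 < (r + (1 : ℝ) • (p - r)) i := by simpa using hp
  have hd : ∀ t : ℝ, HasDerivAt (fun t => m * ‖p - r‖ ^ 2 * (t ^ 2 / 2))
      (m * ‖p - r‖ ^ 2 * t) t := fun t => by
    refine (((hasDerivAt_pow 2 t).div_const 2).const_mul _).congr_deriv ?_
    simp
  have := monotoneOn_total_sub hr hτ hd (fun t ht => by
      have h1 := h (r + t • (p - r)) (segment_pos hr.1 hτ (Ioo_subset_Icc_self ht)) (by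
        simp only [Pi.add_apply, Pi.smul_apply, smul_eq_mul, Finset.sum_add_distrib,
          ← Finset.mul_sum, sum_sub_eq_zero hsum, mul_zero, add_zero])
      have h2 : ∑ i, extCurvature T (r + t • (p - r)) i * ((r + t • (p - r)) i - r i) =
          t * lineDerivTotal T r (p - r) t := by
        unfold lineDerivTotal
        rw [Finset.mul_sum]
        refine Finset.sum_congr rfl fun i _ => ?_
        simp only [Pi.add_apply, Pi.smul_apply, smul_eq_mul, add_sub_cancel_left]
        ring
      rw [h2, add_sub_cancel_left, norm_smul, mul_pow, Real.norm_eq_abs, sq_abs] at h1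
      refine le_of_mul_le_mul_left ?_ ht.1
      linarith)
    (left_mem_Icc.2 zero_le_one) (right_mem_Icc.2 zero_le_one) zero_le_one
  simp at this
  linarith

end BallPacking

namespace BallPacking

variable {V : Type*} [Fintype V] [DecidableEq V] {T : AbstractSimplicialComplex V}

/-! ### The invariant `chi` and sublevel sets of the average curvature -/

lemma mem_packings_of_lt_exitTime {r γ : V → ℝ} {t : ℝ} (ht : t ∈ Ico 0 (exitTime T r γ)) :
    r + t • γ ∈ packings T := by
  obtain ⟨a, ha, hta⟩ := exists_lt_of_lt_csSup (s := {a : ℝ | ∀ t ∈ Ico 0 a,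
    r + t • γ ∈ packings T}) ⟨0, by simpa using fun t h0 h1 => absurd h0 (not_le.2 h1)⟩ ht.2
  exact ha t ⟨ht.1, hta⟩

lemma exitTime_le {r γ : V → ℝ} {s : ℝ} (hs : 0 ≤ s) (h : r + s • γ ∉ packings T) :
    exitTime T r γ ≤ s := by
  refine csSup_le ⟨0, by simpa using fun t h0 h1 => absurd h0 (not_le.2 h1)⟩ fun a ha => ?_
  by_contra hlt
  exact h (ha s ⟨hs, not_le.1 hlt⟩)

/-- Polar coordinates in the hyperplane of vectors with coordinate sum zero. -/
lemma exists_direction {η : V → ℝ} (hη : ∑ i, η i = 0) (h0 : η ≠ 0) :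
    ∃ s > 0, ∃ γ ∈ directions V, η = s • γ ∧ s ^ 2 = ∑ i, η i ^ 2 := by
  have hpos : 0 < ∑ i, η i ^ 2 := by
    obtain ⟨i, hi⟩ := Function.ne_iff.1 h0
    exact Finset.sum_pos' (fun i _ => sq_nonneg _) ⟨i, Finset.mem_univ i, by
      have : η i ≠ 0 := hi
      positivity⟩
  have hs := Real.sqrt_pos.2 hpos
  have hsq := Real.sq_sqrt hpos.le
  refine ⟨√(∑ i, η i ^ 2), hs, (√(∑ i, η i ^ 2))⁻¹ • η, ⟨?_, ?_⟩, ?_, hsq⟩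
  · simp only [Pi.smul_apply, smul_eq_mul, mul_pow, ← Finset.mul_sum]
    rw [inv_pow, hsq, inv_mul_cancel₀ hpos.ne']
  · simp only [Pi.smul_apply, smul_eq_mul, ← Finset.mul_sum, hη, mul_zero]
  · rw [smul_smul, mul_inv_cancel₀ hs.ne', one_smul]

lemma sum_line {r γ : V → ℝ} (hγ : γ ∈ directions V) (t : ℝ) :
    ∑ i, (r + t • γ) i = ∑ i, r i := by
  simp only [Pi.add_apply, Pi.smul_apply, smul_eq_mul, Finset.sum_add_distrib, ← Finset.mul_sum,
    hγ.2, mul_zero, add_zero]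

/-- If `p` were not a packing, the ray from `r` through `p` would leave the packings no later than
at `p`. As the total curvature increases up to `p`, the supremum on this ray, hence `chi`, would be
at most the value at `p`. -/
lemma mem_packings_of_lt_chi {r p : V → ℝ} (hr : r ∈ packings T) {c : ℝ}
    (hc : ∀ i, curvature T r i = c) (hp : ∀ i, 0 < p i) (hsum : ∑ i, p i = ∑ i, r i)
    (hlt : ((totalCurvature T p / ∑ i, r i : ℝ) : EReal) < chi T r) : p ∈ packings T := by
  by_contra hpM
  have hne : p - r ≠ 0 := fun h => hpM (sub_eq_zero.1 h ▸ hr)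
  obtain ⟨s, hs, γ, hγ, hη, -⟩ := exists_direction (sum_sub_eq_zero hsum) hne
  have hps : r + s • γ = p := by rw [← hη]; simp
  have hexit := exitTime_le hs.le (hps.symm ▸ hpM : r + s • γ ∉ packings T)
  refine absurd hlt (not_lt.2 (iInf₂_le_of_le γ hγ (iSup₂_le fun t ht => ?_)))
  have hm := mem_packings_of_lt_exitTime ht
  rw [avgCurvature_eq hm, sum_line hγ, EReal.coe_le_coe_iff]
  have hts : t ≤ s := (ht.2.trans_le hexit).le
  have := monotoneOn_total_ray hr hc hγ.2 (hps.symm ▸ hp : ∀ i, 0 < (r + s • γ) i)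
    ⟨ht.1, hts⟩ (right_mem_Icc.2 hs.le) hts
  simp only [hps] at this
  exact div_le_div_of_nonneg_right this (Finset.sum_nonneg fun i _ => (hr.1 i).le)

/-- The ray from `r` through `p` reaches a packing of average curvature above some `μ' > μ`. The
Lipschitz bound forces it to continue past `p` by a definite length with positive coordinates, so no
coordinate of `p` is close to zero. -/
lemma exists_lower_bound [Nonempty V] {r : V → ℝ} (hr : r ∈ packings T) {c : ℝ}
    (hc : ∀ i, curvature T r i = c) {μ : ℝ} (hμ : (μ : EReal) < chi T r) :
    ∃ θ > 0, ∀ p : V → ℝ, (∀ i, 0 < p i) → ∑ i, p i = ∑ i, r i →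
      totalCurvature T p ≤ μ * ∑ i, r i → ∀ i, θ * r i ≤ p i := by
  obtain ⟨μ', hμ1, hμ2⟩ := EReal.lt_iff_exists_real_btwn.1 hμ
  rw [EReal.coe_lt_coe_iff] at hμ1
  obtain ⟨B, hB, hKB⟩ := exists_abs_extCurvature_le T
  set R := ∑ i, r i with hR
  have hR0 : 0 < R := Finset.sum_pos (fun i _ => hr.1 i) Finset.univ_nonempty
  set N : ℝ := (Fintype.card V : ℝ) with hN
  have hN1 : 1 ≤ N := Nat.one_le_cast.2 Fintype.card_pos
  set L := B * N
  have hL : 0 < L := by positivity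
  -- A lower bound for the parameter length needed to raise the total curvature from `μ R` to `μ' R`
  -- with slope at most `L`.
  set κ := (μ' - μ) * R / L
  have hκ : 0 < κ := div_pos (mul_pos (sub_pos.2 hμ1) hR0) hL
  -- The constant comes from solving `κ (r_i - p_i) ≤ p_i N R` for `p_i`.
  refine ⟨κ / (N * R + κ), by positivity, fun p hp hsum hle i => ?_⟩
  rw [div_mul_eq_mul_div, div_le_iff₀ (by positivity)]
  rcases le_or_gt (r i) (p i) with hpi | hpi
  · nlinarith [mul_pos (hp i) (show 0 < N * R by positivity)]
  have hne : p - r ≠ 0 := fun h => hpi.ne (by rw [sub_eq_zero.1 h])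
  obtain ⟨s, hs, γ, hγ, hη, hs2⟩ := exists_direction (sum_sub_eq_zero hsum) hne
  have hps : r + s • γ = p := by rw [← hη]; simp
  have hsle : s ≤ N * R := by
    refine le_of_sq_le_sq (hs2.le.trans ?_) (by positivity)
    have h1 : ∑ i, (p - r) i ^ 2 ≤ N * R ^ 2 := by
      rw [hN, ← nsmul_eq_mul, ← Finset.card_univ]
      refine Finset.sum_le_card_nsmul _ _ _ fun i _ => ?_
      rw [← sq_abs]
      exact pow_le_pow_left₀ (abs_nonneg _)
        ((norm_le_pi_norm (p - r) i).trans (norm_sub_le_sum hp hr.1 hsum)) 2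
    refine h1.trans ?_
    rw [mul_pow]
    exact mul_le_mul_of_nonneg_right (by nlinarith) (by positivity)
  have hsup : (μ' : EReal) < ⨆ t ∈ Ico 0 (exitTime T r γ),
      ((avgCurvature T (r + t • γ) : ℝ) : EReal) := hμ2.trans_le (iInf₂_le γ hγ)
  obtain ⟨t, ht⟩ := lt_iSup_iff.1 hsup
  obtain ⟨htI, ht⟩ := lt_iSup_iff.1 ht
  have hm := mem_packings_of_lt_exitTime htI
  rw [EReal.coe_lt_coe_iff, avgCurvature_eq hm, sum_line hγ, lt_div_iff₀ hR0] at ht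
  have hst : s < t := by
    by_contra hts
    have := monotoneOn_total_ray hr hc hγ.2 (hps.symm ▸ hp : ∀ i, 0 < (r + s • γ) i)
      ⟨htI.1, not_lt.1 hts⟩ (right_mem_Icc.2 hs.le) (not_lt.1 hts)
    simp only [hps] at this
    nlinarith [mul_lt_mul_of_pos_right hμ1 hR0]
  have hLip := monotoneOn_sub_total (φ := fun t => t * L) hr hm.1
    (fun t => (hasDerivAt_id t).mul_const L)
    (fun u _ => by
      rw [one_mul]
      refine (le_abs_self _).trans ((Finset.abs_sum_le_sum_abs _ _).trans ?_)
      rw [show L = N * B from mul_comm _ _, hN, ← nsmul_eq_mul, ← Finset.card_univ]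
      refine Finset.sum_le_card_nsmul _ _ _ fun i _ => ?_
      rw [abs_mul]
      have h1 : γ i ^ 2 ≤ 1 := hγ.1 ▸ Finset.single_le_sum (f := fun i => γ i ^ 2)
        (fun i _ => sq_nonneg _) (Finset.mem_univ i)
      have h2 : |γ i| ≤ 1 := by
        rw [← sq_abs] at h1
        exact (sq_le_one_iff₀ (abs_nonneg _)).1 h1
      calc _ ≤ B * 1 := mul_le_mul (hKB _ _) h2 (abs_nonneg _) hB.le
        _ = B := mul_one B)
    ⟨hs.le, hst.le⟩ (right_mem_Icc.2 htI.1) hst.le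
  simp only [hps] at hLip
  have hκle : κ ≤ t - s := by
    rw [div_le_iff₀ hL]
    nlinarith
  have h1 := hm.1 i
  have h2 : p i = r i + s * γ i := by rw [← hps]; simp
  simp only [Pi.add_apply, Pi.smul_apply, smul_eq_mul] at h1
  have hγi : γ i < 0 := by
    by_contra h
    nlinarith [mul_nonneg hs.le (not_lt.1 h)]
  -- Coordinate `i` decreases at rate `-γ i` for a further length at least `κ` and is still
  -- positive.
  have h3 : κ * (-γ i) ≤ p i := by nlinarith [mul_le_mul_of_nonneg_right hκle (neg_pos.2 hγi).le]
  have h4 : κ * (r i - p i) ≤ p i * s := by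
    calc κ * (r i - p i) = κ * (-γ i) * s := by rw [h2]; ring
      _ ≤ p i * s := mul_le_mul_of_nonneg_right h3 hs.le
  nlinarith [mul_le_mul_of_nonneg_left hsle (hp i).le]

/-- Sublevel sets of the average curvature below `chi` are compact and consist of ball packings. -/
lemma exists_compact_sublevel [Nonempty V] {r : V → ℝ} (hr : r ∈ packings T) {c : ℝ}
    (hc : ∀ i, curvature T r i = c) {μ : ℝ} (hμ : (μ : EReal) < chi T r) :
    ∃ K : Set (V → ℝ), IsCompact K ∧ K ⊆ packings T ∧ ∀ p : V → ℝ, p ∈ K ↔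
      (∀ i, 0 < p i) ∧ ∑ i, p i = ∑ i, r i ∧ totalCurvature T p ≤ μ * ∑ i, r i := by
  obtain ⟨θ, hθ, hlow⟩ := exists_lower_bound hr hc hμ
  set R := ∑ i, r i with hR
  refine ⟨{p | (∀ i, 0 < p i) ∧ ∑ i, p i = R ∧ totalCurvature T p ≤ μ * R}, ?_, ?_,
    fun p => Iff.rfl⟩
  -- This box stays away from the boundary of the orthant, so the total curvature is continuous on
  -- it and closedness of the sublevel set follows.
  · let C : Set (V → ℝ) := Icc (fun i => θ * r i) (fun _ => R)
    have hpos : ∀ p ∈ C, ∀ i, 0 < p i := fun p hp i => (mul_pos hθ (hr.1 i)).trans_le (hp.1 i)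
    have hC : IsCompact C := isCompact_Icc
    have hcl : IsClosed (C ∩ totalCurvature T ⁻¹' Iic (μ * R)) :=
      ContinuousOn.preimage_isClosed_of_isClosed
        (fun p hp => (continuousAt_totalCurvature (hpos p hp)).continuousWithinAt)
        hC.isClosed isClosed_Iic
    have hcl2 : IsClosed {p : V → ℝ | ∑ i, p i = R} :=
      isClosed_eq (by fun_prop) continuous_const
    refine (hC.inter_right (hcl.inter hcl2)).of_isClosed_subset ?_ ?_
    · convert hcl.inter hcl2 using 1
      ext p
      constructor
      · rintro ⟨h1, h2, h3⟩
        refine ⟨⟨⟨hlow p h1 h2 h3, fun i => ?_⟩, h3⟩, h2⟩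
        exact h2 ▸ Finset.single_le_sum (f := p) (fun i _ => (h1 i).le) (Finset.mem_univ i)
      · rintro ⟨⟨h1, h2⟩, h3⟩
        exact ⟨hpos p h1, h3, h2⟩
    · rintro p ⟨h1, h2, h3⟩
      have hpC : p ∈ C := ⟨hlow p h1 h2 h3, fun i =>
        h2 ▸ Finset.single_le_sum (f := p) (fun i _ => (h1 i).le) (Finset.mem_univ i)⟩
      exact ⟨hpC, ⟨hpC, h3⟩, h2⟩
  · rintro p ⟨h1, h2, h3⟩
    refine mem_packings_of_lt_chi hr hc h1 h2 (lt_of_le_of_lt ?_ hμ)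
    rw [EReal.coe_le_coe_iff]
    exact (div_le_iff₀ (Finset.sum_pos (fun i _ => hr.1 i) Finset.univ_nonempty)).2 h3

lemma totalCurvature_const {r : V → ℝ} (hr : r ∈ packings T) {c : ℝ}
    (hc : ∀ i, curvature T r i = c) : totalCurvature T r = c * ∑ i, r i := by
  unfold totalCurvature
  simp only [extCurvature_const hr hc, ← Finset.mul_sum]

/-- If the average curvature is below `chi`, the derivative of the curvature is definite. -/
lemma eq_zero_of_form_eq_zero {r : V → ℝ} (hr : r ∈ packings T) {c : ℝ}
    (hc : ∀ i, curvature T r i = c) (hlt : (c : EReal) < chi T r) {η : V → ℝ}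
    (hη : ∑ i, η i = 0) (h0 : ∑ i, η i * curvatureDeriv T r η i = 0) : η = 0 := by
  by_contra hne
  obtain ⟨i₀, -⟩ := Function.ne_iff.1 hne
  have hR0 : 0 < ∑ i, r i := Finset.sum_pos (fun i _ => hr.1 i) ⟨i₀, Finset.mem_univ _⟩
  obtain ⟨s, hs, γ, hγ, hsγ, -⟩ := exists_direction hη hne
  -- On each tetrahedron `γ` is proportional to `r`, so moving along the ray only rescales the
  -- tetrahedra. The curvature remains `c`, and the ray shows `chi ≤ c`.
  refine absurd hlt (not_lt.2 (iInf₂_le_of_le γ hγ (iSup₂_le fun t ht => ?_)))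
  have hm := mem_packings_of_lt_exitTime ht
  have hK : ∀ i, extCurvature T (r + t • γ) i = c := by
    intro i
    rw [← extCurvature_const hr hc i]
    refine extCurvature_congr_scale i fun j k l h => ?_
    obtain ⟨h1, h2, h3⟩ := ratio_eq_of_form_eq_zero hr h0 h
    have e : ∀ a, η a * (r a)⁻¹ = η l * (r l)⁻¹ →
        (r + t • γ) a = (1 + t * (γ l * (r l)⁻¹)) * r a := by
      intro a ha
      rw [hsγ] at ha
      simp only [Pi.smul_apply, smul_eq_mul, mul_assoc] at ha
      have := mul_left_cancel₀ hs.ne' ha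
      have hra := (hr.1 a).ne'
      simp only [Pi.add_apply, Pi.smul_apply, smul_eq_mul]
      rw [← this]
      field_simp
    refine ⟨1 + t * (γ l * (r l)⁻¹), ?_, e i h1, e j h2, e k h3, e l rfl⟩
    have := hm.1 l
    rw [e l rfl] at this
    exact pos_of_mul_pos_left this (hr.1 l).le
  rw [avgCurvature_eq hm, EReal.coe_le_coe_iff]
  unfold totalCurvature
  simp only [hK, ← Finset.mul_sum]
  rw [sum_line hγ, mul_div_cancel_right₀ _ hR0.ne']

end BallPacking


/-! ### Global solutions of cut-off vector fields -/

section ODE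

open Topology

variable {E : Type*} [NormedAddCommGroup E] [NormedSpace ℝ E]

/-- A global bound on the field lets Picard–Lindelöf work on intervals of any length; the solutions
are glued by uniqueness. -/
lemma exists_global_solution [CompleteSpace E] {w : E → E} {C : NNReal} (hC : LipschitzWith C w) {L : NNReal}
    (hL : ∀ x, ‖w x‖ ≤ L) (x₀ : E) :
    ∃ α : ℝ → E, α 0 = x₀ ∧ ∀ t, HasDerivAt α (w (α t)) t := by
  have hloc : ∀ n : ℕ, ∃ α : ℝ → E, α 0 = x₀ ∧
      ∀ t ∈ Ioo (-(n + 1 : ℝ)) (n + 1), HasDerivAt α (w (α t)) t := by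
    intro n
    have h0 : (0 : ℝ) ∈ Icc (-(n + 1 : ℝ)) (n + 1) := ⟨by linarith, by positivity⟩
    have hpl : IsPicardLindelof (fun _ => w) (⟨0, h0⟩ : Icc (-(n + 1 : ℝ)) (n + 1)) x₀
        (L * (n + 1)) 0 L C :=
      .of_time_independent (fun x _ => hL x) hC.lipschitzOnWith (by simp)
    obtain ⟨α, h1, h2⟩ := hpl.exists_eq_forall_mem_Icc_hasDerivWithinAt₀
    exact ⟨α, h1, fun t ht => (h2 t (Ioo_subset_Icc_self ht)).hasDerivAt (Icc_mem_nhds ht.1 ht.2)⟩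
  choose α h0 hα using hloc
  have heq : ∀ m n : ℕ, m ≤ n → EqOn (α m) (α n) (Ioo (-(m + 1 : ℝ)) (m + 1)) := by
    intro m n hmn
    have hmn' : (m : ℝ) ≤ n := by exact_mod_cast hmn
    refine ODE_solution_unique_of_mem_Ioo (v := fun _ => w) (s := fun _ => univ) (t₀ := 0)
      (fun _ _ => hC.lipschitzOnWith) ⟨by linarith, by positivity⟩
      (fun t ht => ⟨hα m t ht, mem_univ _⟩)
      (fun t ht => ⟨hα n t ⟨by linarith [ht.1], by linarith [ht.2]⟩, mem_univ _⟩)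
      ((h0 m).trans (h0 n).symm)
  -- The index is chosen so that `t` is interior to the interval of the solution used at `t`.
  refine ⟨fun t => α ⌈|t|⌉₊ t, h0 _, fun t => ?_⟩
  have hN : |t| < (⌈|t|⌉₊ : ℝ) + 1 := (Nat.le_ceil _).trans_lt (lt_add_one _)
  have hmem : t ∈ Ioo (-((⌈|t|⌉₊ : ℝ) + 1)) (⌈|t|⌉₊ + 1) := abs_lt.1 hN
  have hev : (fun s => α ⌈|s|⌉₊ s) =ᶠ[𝓝 t] α (⌈|t|⌉₊ + 1) := by
    filter_upwards [Ioo_mem_nhds hmem.1 hmem.2] with s hs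
    refine heq _ _ ?_ (abs_lt.1 ((Nat.le_ceil _).trans_lt (lt_add_one _)))
    refine Nat.ceil_le.2 ?_
    push_cast
    exact (abs_lt.2 hs).le
  have h2 := hα (⌈|t|⌉₊ + 1) t (by push_cast; exact ⟨by linarith [hmem.1], by linarith [hmem.2]⟩)
  rw [← hev.eq_of_nhds] at h2
  exact h2.congr_of_eventuallyEq hev

/-- The cut-off field is of class `C¹` with compact support, hence bounded and globally Lipschitz,
and it agrees with `v` on `K`. -/
lemma exists_cutoff [FiniteDimensional ℝ E] {U K : Set E} (hU : IsOpen U) (hK : IsCompact K)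
    (hKU : K ⊆ U) {v : E → E} (hv : ∀ x ∈ U, ContDiffAt ℝ 1 v x) :
    ∃ ρ : E → ℝ, (∀ x, 0 ≤ ρ x) ∧ (∀ x ∈ K, ρ x = 1) ∧ (∀ x ∉ U, ρ x = 0) ∧
      (∃ C : NNReal, LipschitzWith C fun x => ρ x • v x) ∧
      ∃ L : NNReal, ∀ x, ‖ρ x • v x‖ ≤ L := by
  obtain ⟨K', hK', hKK', hK'U⟩ := exists_compact_between hK hU hKU
  obtain ⟨f, hf1, hf0, hf⟩ := exists_contMDiffMap_one_nhds_of_subset_interior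
    (n := ⊤) (modelWithCornersSelf ℝ E) hK.isClosed hKK'
  have hf' : ContDiff ℝ 1 f := f.contMDiff.contDiff.of_le (by simp)
  have hw : ContDiff ℝ 1 fun x => f x • v x := by
    rw [contDiff_iff_contDiffAt]
    intro x
    by_cases hx : x ∈ U
    · exact hf'.contDiffAt.smul (hv x hx)
    · have hev : (fun x => f x • v x) =ᶠ[𝓝 x] fun _ => 0 := by
        filter_upwards [hK'.isClosed.isOpen_compl.mem_nhds fun h => hx (hK'U h)] with y hy
        rw [hf0 y hy, zero_smul]
      exact contDiffAt_const.congr_of_eventuallyEq hev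
  have hsupp : HasCompactSupport fun x => f x • v x :=
    HasCompactSupport.intro hK' fun x hx => by rw [hf0 x hx, zero_smul]
  obtain ⟨L, hL⟩ := hsupp.exists_bound_of_continuous hw.continuous
  refine ⟨f, fun x => (hf x).1, fun x hx => ?_, fun x hx => hf0 x fun h => hx (hK'U h),
    hw.lipschitzWith_of_hasCompactSupport hsupp one_ne_zero,
    ⟨L.toNNReal, fun x => (hL x).trans (Real.le_coe_toNNReal L)⟩⟩
  exact (hf1.filter_mono (nhds_le_nhdsSet hx)).self_of_nhds

/-- On `[0, t]` both trajectories trace compact subsets of `U`; both solve a common cut-off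
equation, which is globally Lipschitz. -/
lemma solution_unique_of_contDiffAt [FiniteDimensional ℝ E] {U : Set E} (hU : IsOpen U)
    {v : E → E} (hv : ∀ x ∈ U, ContDiffAt ℝ 1 v x) {τ : ℝ} {f g : ℝ → E} (h0 : f 0 = g 0)
    (hf : ∀ t ∈ Ico 0 τ, f t ∈ U ∧ HasDerivWithinAt f (v (f t)) (Ico 0 τ) t)
    (hg : ∀ t ∈ Ico 0 τ, g t ∈ U ∧ HasDerivWithinAt g (v (g t)) (Ico 0 τ) t) :
    EqOn f g (Ico 0 τ) := by
  intro t ht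
  have hsub : Icc 0 t ⊆ Ico 0 τ := fun s hs => ⟨hs.1, hs.2.trans_lt ht.2⟩
  have hfc : ContinuousOn f (Icc 0 t) := fun s hs =>
    (hf s (hsub hs)).2.continuousWithinAt.mono hsub
  have hgc : ContinuousOn g (Icc 0 t) := fun s hs =>
    (hg s (hsub hs)).2.continuousWithinAt.mono hsub
  obtain ⟨ρ, -, hρ1, -, ⟨C, hC⟩, -⟩ := exists_cutoff hU
    ((isCompact_Icc.image_of_continuousOn hfc).union (isCompact_Icc.image_of_continuousOn hgc))
    (union_subset (image_subset_iff.2 fun s hs => (hf s (hsub hs)).1)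
      (image_subset_iff.2 fun s hs => (hg s (hsub hs)).1)) hv
  have hnhds : ∀ s ∈ Ico 0 t, Ico 0 τ ∈ 𝓝[Ici s] s := fun s hs =>
    mem_nhdsWithin.2 ⟨Iio τ, isOpen_Iio, hs.2.trans ht.2, fun x hx => ⟨hs.1.trans hx.2, hx.1⟩⟩
  refine ODE_solution_unique (v := fun _ x => ρ x • v x) (fun _ => hC) hfc (fun s hs => ?_) hgc
    (fun s hs => ?_) h0 (right_mem_Icc.2 ht.1)
  · have hs' := Ico_subset_Icc_self hs
    rw [hρ1 _ (.inl (mem_image_of_mem f hs')), one_smul]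
    exact (hf s (hsub hs')).2.mono_of_mem_nhdsWithin (hnhds s hs)
  · have hs' := Ico_subset_Icc_self hs
    rw [hρ1 _ (.inr (mem_image_of_mem g hs')), one_smul]
    exact (hg s (hsub hs')).2.mono_of_mem_nhdsWithin (hnhds s hs)

end ODE

namespace BallPacking

variable {V : Type*} [Fintype V] [DecidableEq V] {T : AbstractSimplicialComplex V}

/-! ### The flow -/

/-- The average of the extended curvature. -/
def extAvgCurvature (T : AbstractSimplicialComplex V) (r : V → ℝ) : ℝ :=
  totalCurvature T r / ∑ i, r i

/-- The vector field of the normalized combinatorial Yamabe flow. -/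
def flowField (T : AbstractSimplicialComplex V) (r : V → ℝ) (i : V) : ℝ :=
  (extAvgCurvature T r - extCurvature T r i) * r i

/-- The dissipation of the total curvature along the flow. -/
def dissipation (T : AbstractSimplicialComplex V) (r : V → ℝ) : ℝ :=
  ∑ i, (extCurvature T r i - extAvgCurvature T r) ^ 2 * r i

lemma flowField_eq {r : V → ℝ} (hr : r ∈ packings T) (i : V) :
    flowField T r i = (avgCurvature T r - curvature T r i) * r i := by
  rw [flowField, extAvgCurvature, avgCurvature_eq hr, extCurvature_eq hr]

lemma sum_pos_of_pos [Nonempty V] {r : V → ℝ} (hr : ∀ i, 0 < r i) : 0 < ∑ i, r i :=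
  Finset.sum_pos (fun i _ => hr i) Finset.univ_nonempty

lemma contDiffAt_flowField [Nonempty V] {r : V → ℝ} (hr : r ∈ packings T) :
    ContDiffAt ℝ 1 (flowField T) r := by
  have happ : ∀ i, ContDiffAt ℝ 1 (fun p : V → ℝ => p i) r := fun i => contDiffAt_apply ℝ ℝ i r
  refine contDiffAt_pi.2 fun i => ContDiffAt.mul (ContDiffAt.sub (ContDiffAt.div ?_ ?_ ?_)
    (contDiffAt_extCurvature hr i)) (happ i)
  · exact ContDiffAt.sum fun i _ => (contDiffAt_extCurvature hr i).mul (happ i)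
  · exact ContDiffAt.sum fun i _ => happ i
  · exact (sum_pos_of_pos hr.1).ne'

lemma sum_flowField [Nonempty V] {r : V → ℝ} (hr : ∀ i, 0 < r i) : ∑ i, flowField T r i = 0 := by
  have h : extAvgCurvature T r * ∑ i, r i = totalCurvature T r :=
    div_mul_cancel₀ _ (sum_pos_of_pos hr).ne'
  simp only [flowField, sub_mul, Finset.sum_sub_distrib, ← Finset.mul_sum]
  rw [h, totalCurvature, sub_self]

/-- The field has sum zero, so the average may be subtracted from the curvature, leaving a weighted
variance. -/
lemma sum_mul_flowField [Nonempty V] {r : V → ℝ} (hr : ∀ i, 0 < r i) :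
    ∑ i, extCurvature T r i * flowField T r i = -dissipation T r := by
  have h := sum_flowField (T := T) hr
  have h2 : ∑ i, extCurvature T r i * flowField T r i =
      ∑ i, (extCurvature T r i - extAvgCurvature T r) * flowField T r i := by
    simp only [sub_mul, Finset.sum_sub_distrib, ← Finset.mul_sum, h, mul_zero, sub_zero]
  rw [h2, dissipation, ← Finset.sum_neg_distrib]
  refine Finset.sum_congr rfl fun i _ => ?_
  unfold flowField
  ring

lemma dissipation_nonneg {r : V → ℝ} (hr : ∀ i, 0 < r i) : 0 ≤ dissipation T r :=
  Finset.sum_nonneg fun i _ => mul_nonneg (sq_nonneg _) (hr i).le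

/-- The factor `a` stands for the value of the cut-off function, or is `1` for the flow itself. -/
lemma hasDerivAt_total_flow [Nonempty V] {α : ℝ → V → ℝ} {t a : ℝ} (hα : α t ∈ packings T)
    (hd : HasDerivAt α (a • flowField T (α t)) t) :
    HasDerivAt (fun s => totalCurvature T (α s)) (-(a * dissipation T (α t))) t := by
  refine (hasDerivAt_totalCurvature (hasDerivAt_pi.1 hd) hα.1
    fun i j k l h => (hα.2 i j k l h).ne').congr_deriv ?_
  rw [← mul_neg, ← sum_mul_flowField hα.1, Finset.mul_sum]
  refine Finset.sum_congr rfl fun i _ => ?_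
  simp only [Pi.smul_apply, smul_eq_mul]
  ring

lemma hasDerivAt_sum_flow [Nonempty V] {α : ℝ → V → ℝ} {t a : ℝ}
    (ha : α t ∉ packings T → a = 0) (hd : HasDerivAt α (a • flowField T (α t)) t) :
    HasDerivAt (fun s => ∑ i, α s i) 0 t := by
  refine (HasDerivAt.fun_sum fun i _ => hasDerivAt_pi.1 hd i).congr_deriv ?_
  simp only [Pi.smul_apply, smul_eq_mul, ← Finset.mul_sum]
  by_cases h : α t ∈ packings T
  · rw [sum_flowField h.1, mul_zero]
  · rw [ha h, zero_mul]

/-- For a short time the flow exists, and strictly decreases the total curvature. -/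
lemma exists_short_time [Nonempty V] {r₀ : V → ℝ} (hr₀ : r₀ ∈ packings T)
    (hpos : 0 < dissipation T r₀) :
    ∃ β : ℝ → V → ℝ, ∃ t₁ > 0, β 0 = r₀ ∧ totalCurvature T (β t₁) < totalCurvature T r₀ ∧
      ∀ t ∈ Icc 0 t₁, β t ∈ packings T ∧ HasDerivAt β (flowField T (β t)) t := by
  obtain ⟨β, h0, ε, hε, hβ⟩ :=
    (contDiffAt_flowField hr₀).exists_forall_mem_closedBall_exists_eq_forall_mem_Ioo_hasDerivAt₀ 0
  have hβ0 := hβ 0 ⟨by linarith, by linarith⟩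
  have hd : HasDerivAt (fun s => totalCurvature T (β s)) (-(1 * dissipation T (β 0))) 0 :=
    hasDerivAt_total_flow (h0 ▸ hr₀) (by simpa using hβ0)
  have h1 : ∀ᶠ t in nhds (0 : ℝ), β t ∈ packings T :=
    hβ0.continuousAt ((isOpen_packings T).mem_nhds (h0 ▸ hr₀))
  have h2 : ∀ᶠ t in nhdsWithin (0 : ℝ) {0}ᶜ,
      slope (fun s => totalCurvature T (β s)) 0 t < 0 :=
    (hasDerivAt_iff_tendsto_slope.1 hd).eventually_lt_const (by rw [h0]; linarith)
  obtain ⟨δ₁, hδ₁, hball₁⟩ := Metric.eventually_nhds_iff.1 h1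
  obtain ⟨δ₂, hδ₂, hball₂⟩ := Metric.eventually_nhds_iff.1 (eventually_nhdsWithin_iff.1 h2)
  set t₁ := min ε (min δ₁ δ₂) / 2 with ht₁
  have hm : 0 < min ε (min δ₁ δ₂) := lt_min hε (lt_min hδ₁ hδ₂)
  have ht0 : 0 < t₁ := by positivity
  have hlt : t₁ < min ε (min δ₁ δ₂) := half_lt_self hm
  obtain ⟨l1, l2⟩ := lt_min_iff.1 hlt
  obtain ⟨l2, l3⟩ := lt_min_iff.1 l2
  refine ⟨β, t₁, ht0, h0, ?_, fun t ht => ⟨hball₁ ?_, hβ t ⟨by linarith [ht.1], by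
    linarith [ht.2]⟩⟩⟩
  · have := hball₂ (y := t₁) (by rw [Real.dist_0_eq_abs, abs_of_pos ht0]; exact l3)
      (by simpa using ht0.ne')
    rw [slope_def_field, sub_zero, div_neg_iff] at this
    rcases this with h | h
    · linarith
    · rw [h0] at h; linarith
  · rw [Real.dist_0_eq_abs, abs_of_nonneg ht.1]
    linarith [ht.2]

/-- Continuous induction: the times spent in `K` form a closed set, and from a time in `K` the
solution stays for a while in the open set of packings, where the total curvature cannot increase.
-/
lemma mem_sublevel_of_cutoff_flow [Nonempty V] {K : Set (V → ℝ)} (hK : IsCompact K)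
    (hKM : K ⊆ packings T) {R S : ℝ} (hmem : ∀ p : V → ℝ, p ∈ K ↔
      (∀ i, 0 < p i) ∧ ∑ i, p i = R ∧ totalCurvature T p ≤ S) {ρ : (V → ℝ) → ℝ}
    (hρ : ∀ p, 0 ≤ ρ p) (hρ0 : ∀ p ∉ packings T, ρ p = 0) {α : ℝ → V → ℝ}
    (hα : ∀ t, HasDerivAt α (ρ (α t) • flowField T (α t)) t) {t₁ : ℝ} (h1 : α t₁ ∈ K)
    {t : ℝ} (ht : t₁ ≤ t) : α t ∈ K := by
  have hcont : Continuous α := continuous_iff_continuousAt.2 fun t => (hα t).continuousAt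
  have hsum : ∀ s, ∑ i, α s i = R := fun s => by
    rw [← ((hmem _).1 h1).2.1]
    exact is_const_of_deriv_eq_zero (f := fun s => ∑ i, α s i)
      (fun t => (hasDerivAt_sum_flow (hρ0 _) (hα t)).differentiableAt)
      (fun t => (hasDerivAt_sum_flow (hρ0 _) (hα t)).deriv) s t₁
  suffices h : Icc t₁ t ⊆ α ⁻¹' K from h (right_mem_Icc.2 ht)
  refine IsClosed.Icc_subset_of_forall_exists_gt
    ((hK.isClosed.preimage hcont).inter isClosed_Icc) h1 ?_
  rintro x ⟨hxK, hx⟩ y hy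
  have hev : ∀ᶠ s in nhds x, α s ∈ packings T :=
    hcont.continuousAt ((isOpen_packings T).mem_nhds (hKM hxK))
  obtain ⟨δ, hδ, hball⟩ := Metric.eventually_nhds_iff.1 hev
  set z := min y (x + δ / 2)
  have hxz : x < z := lt_min hy (by linarith)
  have hin : ∀ s ∈ Icc x z, α s ∈ packings T := fun s hs => hball (by
    rw [Real.dist_eq, abs_of_nonneg (by linarith [hs.1])]
    linarith [hs.2, min_le_right y (x + δ / 2)])
  refine ⟨z, (hmem _).2 ⟨(hin z (right_mem_Icc.2 hxz.le)).1, hsum z, ?_⟩, hxz, min_le_left _ _⟩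
  have hanti : AntitoneOn (fun s => totalCurvature T (α s)) (Icc x z) := by
    refine antitoneOn_of_deriv_nonpos (convex_Icc x z) (fun s hs =>
      (hasDerivAt_total_flow (hin s hs) (hα s)).continuousAt.continuousWithinAt) ?_ ?_ <;>
    · rw [interior_Icc]
      intro s hs
      have hd := hasDerivAt_total_flow (hin s (Ioo_subset_Icc_self hs)) (hα s)
      first
        | exact hd.differentiableAt.differentiableWithinAt
        | rw [hd.deriv, neg_nonpos]
          exact mul_nonneg (hρ _) (dissipation_nonneg (hin s (Ioo_subset_Icc_self hs)).1)
  exact (hanti (left_mem_Icc.2 hxz.le) (right_mem_Icc.2 hxz.le) hxz.le).trans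
    ((hmem _).1 hxK).2.2

/-! ### Exponential convergence. -/

/-- An inequality of Łojasiewicz type. -/
lemma exists_dissipation_ge [Nonempty V] {r : V → ℝ} (hr : r ∈ packings T) {m : ℝ} (hm : 0 < m)
    (hgrowth : ∀ p : V → ℝ, (∀ i, 0 < p i) → ∑ i, p i = ∑ i, r i →
      m * ‖p - r‖ ^ 2 ≤ totalCurvature T p - totalCurvature T r) {θ : ℝ} (hθ : 0 < θ) :
    ∃ k > 0, ∀ p : V → ℝ, (∀ i, 0 < p i) → ∑ i, p i = ∑ i, r i → (∀ i, θ * r i ≤ p i) →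
      k * (totalCurvature T p - totalCurvature T r) ≤ dissipation T p := by
  obtain ⟨i₀, hi₀⟩ := Finite.exists_min r
  set ε := θ * r i₀
  have hε : 0 < ε := mul_pos hθ (hr.1 i₀)
  set N : ℝ := (Fintype.card V : ℝ) with hN
  have hN0 : 0 < N := Nat.cast_pos.2 Fintype.card_pos
  -- With `φ` the excess of the total curvature, the constant comes from `m φ ≤ S² ≤ N ∑ (K_i - A)²`
  -- and the lower bound `ε` on the radii.
  refine ⟨m * ε / N, by positivity, fun p hp hsum hlow => ?_⟩
  set φ := totalCurvature T p - totalCurvature T r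
  have hφ0 : 0 ≤ φ := (by positivity : 0 ≤ m * ‖p - r‖ ^ 2).trans (hgrowth p hp hsum)
  set A := extAvgCurvature T p
  set S := ∑ i, |extCurvature T p i - A|
  have hS0 : 0 ≤ S := Finset.sum_nonneg fun i _ => abs_nonneg _
  have h1 : φ ≤ S * ‖p - r‖ := by
    refine (totalCurvature_sub_le hr hp).trans ?_
    have h2 : ∑ i, extCurvature T p i * (p i - r i) =
        ∑ i, (extCurvature T p i - A) * (p - r) i := by
      simp only [sub_mul, Finset.sum_sub_distrib, ← Finset.mul_sum, Pi.sub_apply]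
      rw [hsum, sub_self, mul_zero, sub_zero]
    rw [h2, Finset.sum_mul]
    refine Finset.sum_le_sum fun i _ => (le_abs_self _).trans ?_
    rw [abs_mul]
    exact mul_le_mul_of_nonneg_left (norm_le_pi_norm (p - r) i) (abs_nonneg _)
  -- The distance `‖p - r‖` is eliminated between `φ ≤ S ‖p - r‖` and `m ‖p - r‖² ≤ φ`.
  have h3 : m * φ ≤ S ^ 2 := by
    rcases hφ0.eq_or_lt with h0 | h0
    · rw [← h0, mul_zero]; positivity
    · refine le_of_mul_le_mul_right ?_ h0
      calc m * φ * φ ≤ m * (S * ‖p - r‖) ^ 2 := by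
            rw [mul_assoc, ← pow_two]
            exact mul_le_mul_of_nonneg_left (pow_le_pow_left₀ hφ0 h1 2) hm.le
        _ = S ^ 2 * (m * ‖p - r‖ ^ 2) := by ring
        _ ≤ S ^ 2 * φ := mul_le_mul_of_nonneg_left (hgrowth p hp hsum) (by positivity)
  have h4 : S ^ 2 ≤ N * ∑ i, (extCurvature T p i - A) ^ 2 := by
    have := sq_sum_le_card_mul_sum_sq (s := Finset.univ) (f := fun i => |extCurvature T p i - A|)
    simpa only [sq_abs, Finset.card_univ] using this
  have h5 : ε * ∑ i, (extCurvature T p i - A) ^ 2 ≤ dissipation T p := by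
    rw [Finset.mul_sum]
    refine Finset.sum_le_sum fun i _ => ?_
    rw [mul_comm]
    exact mul_le_mul_of_nonneg_left
      ((mul_le_mul_of_nonneg_left (hi₀ i) hθ.le).trans (hlow i)) (sq_nonneg _)
  rw [div_mul_eq_mul_div, div_le_iff₀ hN0]
  calc m * ε * φ = ε * (m * φ) := by ring
    _ ≤ ε * (N * ∑ i, (extCurvature T p i - A) ^ 2) :=
        mul_le_mul_of_nonneg_left (h3.trans h4) hε.le
    _ = ε * (∑ i, (extCurvature T p i - A) ^ 2) * N := by ring
    _ ≤ dissipation T p * N := mul_le_mul_of_nonneg_right h5 hN0.le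

lemma exp_decay_of_deriv_le {φ φ' : ℝ → ℝ} {k t₁ : ℝ}
    (hd : ∀ t ≥ t₁, HasDerivAt φ (φ' t) t) (hle : ∀ t ≥ t₁, φ' t ≤ -k * φ t) {t : ℝ}
    (ht : t₁ ≤ t) : φ t ≤ φ t₁ * Real.exp (-k * (t - t₁)) := by
  have hder : ∀ s ≥ t₁, HasDerivAt (fun s => φ s * Real.exp (k * (s - t₁)))
      ((φ' s + k * φ s) * Real.exp (k * (s - t₁))) s := fun s hs => by
    have h1 : HasDerivAt (fun s => Real.exp (k * (s - t₁))) (Real.exp (k * (s - t₁)) * k) s := by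
      simpa using (((hasDerivAt_id s).sub_const t₁).const_mul k).exp
    refine ((hd s hs).mul h1).congr_deriv ?_
    ring
  have hanti : AntitoneOn (fun s => φ s * Real.exp (k * (s - t₁))) (Ici t₁) := by
    refine antitoneOn_of_deriv_nonpos (convex_Ici t₁)
      (fun s hs => (hder s hs).continuousAt.continuousWithinAt) ?_ ?_ <;>
    · rw [interior_Ici]
      intro s hs
      have hd' := hder s hs.le
      first
        | exact hd'.differentiableAt.differentiableWithinAt
        | rw [hd'.deriv]
          exact mul_nonpos_of_nonpos_of_nonneg (by linarith [hle s hs.le]) (Real.exp_pos _).le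
  have h2 := hanti (mem_Ici.2 le_rfl) (mem_Ici.2 ht) ht
  simp only [sub_self, mul_zero, Real.exp_zero, mul_one] at h2
  rw [neg_mul, Real.exp_neg, ← div_eq_mul_inv, le_div_iff₀ (Real.exp_pos _)]
  exact h2

/-- Global existence and exponential convergence, for initial data of the same total radius as the
ball packing of constant curvature and of larger average curvature. -/
lemma exists_flow_of_lt [Nonempty V] {r : V → ℝ} (hr : r ∈ packings T) {c : ℝ}
    (hc : ∀ i, curvature T r i = c) {r₀ : V → ℝ} (hr₀ : r₀ ∈ packings T)
    (hsum : ∑ i, r₀ i = ∑ i, r i) (hlt : totalCurvature T r < totalCurvature T r₀)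
    (hgap : ((extAvgCurvature T r₀ : ℝ) : EReal) ≤ chi T r) :
    ∃ α : ℝ → V → ℝ, α 0 = r₀ ∧
      (∀ t ≥ 0, α t ∈ packings T ∧ HasDerivAt α (flowField T (α t)) t) ∧
      ∃ C > 0, ∃ k > 0, ∀ t ≥ 0, ‖α t - r‖ ≤ C * Real.exp (-k * t) := by
  set R := ∑ i, r i with hR
  have hR0 : 0 < R := sum_pos_of_pos hr.1
  have hcR : totalCurvature T r = c * R := totalCurvature_const hr hc
  -- Without dissipation `r₀` would have constant curvature, and the gradient inequality would
  -- contradict `hlt`.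
  have hdiss : 0 < dissipation T r₀ := by
    refine lt_of_le_of_ne (dissipation_nonneg hr₀.1) fun h => ?_
    have h1 : ∀ i, extCurvature T r₀ i = extAvgCurvature T r₀ := fun i => by
      have := (Finset.sum_eq_zero_iff_of_nonneg fun i _ =>
        mul_nonneg (sq_nonneg _) (hr₀.1 i).le).1 h.symm i (Finset.mem_univ i)
      have := (mul_eq_zero.1 this).resolve_right (hr₀.1 i).ne'
      exact sub_eq_zero.1 (pow_eq_zero_iff two_ne_zero |>.1 this)
    have h2 := totalCurvature_sub_le hr hr₀.1
    have h3 := sum_sub_eq_zero hsum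
    simp only [Pi.sub_apply] at h3
    simp only [h1, ← Finset.mul_sum, h3, mul_zero] at h2
    linarith
  have hcchi : (c : EReal) < chi T r := by
    refine lt_of_lt_of_le ?_ hgap
    rw [EReal.coe_lt_coe_iff, extAvgCurvature, hsum, lt_div_iff₀ hR0, ← hcR]
    exact hlt
  obtain ⟨m, hm, hgrowth⟩ := exists_quadratic_growth hr hc
    fun η hη h0 => eq_zero_of_form_eq_zero hr hc hcchi hη h0
  -- Equality is allowed in `hgap`, so an initial stretch of flow is needed to get strictly below
  -- `chi`.
  obtain ⟨β, t₁, ht₁, hβ0, hβlt, hβ⟩ := exists_short_time hr₀ hdiss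
  have hβsum : ∑ i, β t₁ i = R := by
    rw [← hsum, ← hβ0]
    refine constant_of_has_deriv_right_zero (f := fun s => ∑ i, β s i) (a := 0) (b := t₁)
      (fun s hs => ?_) (fun s hs => ?_) t₁ (right_mem_Icc.2 ht₁.le)
    · exact (hasDerivAt_sum_flow (a := 1) (fun h => absurd (hβ s hs).1 h)
        (by simpa using (hβ s hs).2)).continuousAt.continuousWithinAt
    · have hs' := Ico_subset_Icc_self hs
      exact (hasDerivAt_sum_flow (a := 1) (fun h => absurd (hβ s hs').1 h)
        (by simpa using (hβ s hs').2)).hasDerivWithinAt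
  set μ := totalCurvature T (β t₁) / R with hμ
  have hμR : μ * R = totalCurvature T (β t₁) := div_mul_cancel₀ _ hR0.ne'
  have hμchi : (μ : EReal) < chi T r := by
    refine lt_of_lt_of_le ?_ hgap
    rw [EReal.coe_lt_coe_iff, extAvgCurvature, hsum]
    exact div_lt_div_of_pos_right hβlt hR0
  obtain ⟨K, hK, hKM, hmem⟩ := exists_compact_sublevel hr hc hμchi
  obtain ⟨θ, hθ, hlow⟩ := exists_lower_bound hr hc hμchi
  obtain ⟨k, hk, hdis⟩ := exists_dissipation_ge hr hm hgrowth hθ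
  have hβcont : ContinuousOn β (Icc 0 t₁) := fun s hs =>
    (hβ s hs).2.continuousAt.continuousWithinAt
  obtain ⟨ρ, hρ, hρ1, hρ0, ⟨L, hL⟩, ⟨B, hB⟩⟩ := exists_cutoff (isOpen_packings T)
    (hK.union (isCompact_Icc.image_of_continuousOn hβcont))
    (union_subset hKM (image_subset_iff.2 fun s hs => (hβ s hs).1))
    (fun p hp => contDiffAt_flowField (T := T) hp)
  obtain ⟨α, hα0, hα⟩ := exists_global_solution hL hB r₀
  have heq : EqOn α β (Icc 0 t₁) := by
    refine ODE_solution_unique (v := fun _ p => ρ p • flowField T p) (fun _ => hL)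
      (fun s _ => (hα s).continuousAt.continuousWithinAt) (fun s _ => (hα s).hasDerivWithinAt)
      hβcont (fun s hs => ?_) (hα0.trans hβ0.symm)
    have hs' := Ico_subset_Icc_self hs
    rw [hρ1 _ (.inr (mem_image_of_mem β hs')), one_smul]
    exact (hβ s hs').2.hasDerivWithinAt
  have hαt₁ : α t₁ ∈ K := by
    rw [heq (right_mem_Icc.2 ht₁.le)]
    exact (hmem _).2 ⟨(hβ t₁ (right_mem_Icc.2 ht₁.le)).1.1, hβsum, hμR.ge⟩
  have hαK : ∀ t ≥ t₁, α t ∈ K := fun t ht =>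
    mem_sublevel_of_cutoff_flow hK hKM hmem hρ hρ0 hα hαt₁ ht
  have hαU : ∀ t ≥ 0, α t ∈ K ∪ β '' Icc 0 t₁ := fun t ht => by
    rcases le_total t t₁ with h | h
    · exact .inr (heq ⟨ht, h⟩ ▸ mem_image_of_mem β ⟨ht, h⟩)
    · exact .inl (hαK t h)
  have hflow : ∀ t ≥ 0, α t ∈ packings T ∧ HasDerivAt α (flowField T (α t)) t := fun t ht => by
    refine ⟨?_, by simpa only [hρ1 _ (hαU t ht), one_smul] using hα t⟩
    rcases hαU t ht with h | ⟨s, hs, h⟩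
    · exact hKM h
    · exact h ▸ (hβ s hs).1
  have hsumα : ∀ t, ∑ i, α t i = R := fun t => by
    rw [← hsum, ← hα0]
    exact is_const_of_deriv_eq_zero (f := fun s => ∑ i, α s i)
      (fun t => (hasDerivAt_sum_flow (hρ0 _) (hα t)).differentiableAt)
      (fun t => (hasDerivAt_sum_flow (hρ0 _) (hα t)).deriv) t 0
  refine ⟨α, hα0, hflow, ?_⟩
  set φ := fun t => totalCurvature T (α t) - totalCurvature T r with hφ
  have hdecay : ∀ t ≥ t₁, φ t ≤ φ t₁ * Real.exp (-k * (t - t₁)) := fun t ht => by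
    refine exp_decay_of_deriv_le (φ := φ) (φ' := fun t => -dissipation T (α t)) (fun s hs => ?_)
      (fun s hs => ?_) ht
    · have h := hflow s (ht₁.le.trans hs)
      have := hasDerivAt_total_flow (a := 1) h.1 (by simpa using h.2)
      rw [one_mul] at this
      exact this.sub_const _
    · have hsK := (hmem _).1 (hαK s hs)
      have := hdis (α s) hsK.1 hsK.2.1 (hlow _ hsK.1 hsK.2.1 hsK.2.2)
      rw [neg_mul]
      exact neg_le_neg this
  have hφ1 : 0 ≤ φ t₁ := by
    have hsK := (hmem _).1 hαt₁
    exact (by positivity : 0 ≤ m * ‖α t₁ - r‖ ^ 2).trans (hgrowth _ hsK.1 hsK.2.1)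
  -- The distance is controlled by the square root of `φ`, which halves the rate. The summand `R`
  -- covers times before `t₁`, and the exponential moves the time origin from `t₁` to `0`.
  refine ⟨(R + √(φ t₁ / m)) * Real.exp (k / 2 * t₁), by positivity, k / 2, by positivity,
    fun t ht => ?_⟩
  rw [mul_assoc, ← Real.exp_add]
  rcases le_total t t₁ with h | h
  · have h1 : ‖α t - r‖ ≤ R := norm_sub_le_sum (hflow t ht).1.1 hr.1 (hsumα t)
    have h2 : 1 ≤ Real.exp (k / 2 * t₁ + -(k / 2) * t) :=
      Real.one_le_exp (by nlinarith)
    calc ‖α t - r‖ ≤ (R + √(φ t₁ / m)) * 1 := by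
          rw [mul_one]; exact h1.trans (le_add_of_nonneg_right (Real.sqrt_nonneg _))
      _ ≤ _ := mul_le_mul_of_nonneg_left h2 (by positivity)
  · have hsK := (hmem _).1 (hαK t h)
    have h1 := (hgrowth _ hsK.1 hsK.2.1).trans (hdecay t h)
    have h2 : ‖α t - r‖ ≤ √(φ t₁ / m) * Real.exp (k / 2 * t₁ + -(k / 2) * t) := by
      refine le_of_sq_le_sq ?_ (by positivity)
      rw [mul_pow, Real.sq_sqrt (by positivity), ← Real.exp_nat_mul, div_mul_eq_mul_div,
        le_div_iff₀ hm, mul_comm]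
      refine h1.trans (le_of_eq ?_)
      congr 2
      push_cast
      ring
    exact h2.trans (mul_le_mul_of_nonneg_right (le_add_of_nonneg_left hR0.le) (Real.exp_pos _).le)

/-- In the case not covered by `exists_flow_of_lt`, `r₀` minimizes the total curvature, so it has
constant curvature and is a stationary point. -/
lemma exists_flow_normalized [Nonempty V] {r : V → ℝ} (hr : IsConstantCurvaturePacking T r)
    {r₀ : V → ℝ} (hr₀ : r₀ ∈ packings T) (hsum : ∑ i, r₀ i = ∑ i, r i)
    (hgap : ((extAvgCurvature T r₀ : ℝ) : EReal) ≤ chi T r) :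
    ∃ α : ℝ → V → ℝ, α 0 = r₀ ∧
      (∀ t ≥ 0, α t ∈ packings T ∧ HasDerivAt α (flowField T (α t)) t) ∧
      ∃ q, IsConstantCurvaturePacking T q ∧
        ∃ C > 0, ∃ k > 0, ∀ t ≥ 0, ‖α t - q‖ ≤ C * Real.exp (-k * t) := by
  obtain ⟨hrM, c, hc⟩ := hr
  rcases lt_or_ge (totalCurvature T r) (totalCurvature T r₀) with h | h
  · obtain ⟨α, h1, h2, h3⟩ := exists_flow_of_lt hrM hc hr₀ hsum h hgap
    exact ⟨α, h1, h2, r, ⟨hrM, c, hc⟩, h3⟩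
  · have hconst := isConstantCurvature_of_total_le hrM hc hr₀ hsum h
    obtain ⟨-, c', hc'⟩ := hconst
    have hzero : flowField T r₀ = 0 := by
      funext i
      have : extAvgCurvature T r₀ = c' := by
        rw [extAvgCurvature, totalCurvature_const hr₀ hc',
          mul_div_cancel_right₀ _ (sum_pos_of_pos hr₀.1).ne']
      rw [flowField, this, extCurvature_const hr₀ hc', sub_self, zero_mul, Pi.zero_apply]
    refine ⟨fun _ => r₀, rfl, fun t _ => ⟨hr₀, ?_⟩, r₀, ⟨hr₀, c', hc'⟩, 1, one_pos, 1, one_pos,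
      fun t _ => ?_⟩
    · rw [hzero]; exact hasDerivAt_const _ _
    · rw [sub_self, norm_zero]; positivity

/-! ### Scaling, and reduction to equal total radius. -/

lemma totalCurvature_smul (r : V → ℝ) {s : ℝ} (hs : 0 < s) :
    totalCurvature T (s • r) = s * totalCurvature T r := by
  unfold totalCurvature
  simp only [extCurvature_smul r hs, Finset.mul_sum, Pi.smul_apply, smul_eq_mul]
  exact Finset.sum_congr rfl fun i _ => by ring

lemma extAvgCurvature_smul (r : V → ℝ) {s : ℝ} (hs : 0 < s) :
    extAvgCurvature T (s • r) = extAvgCurvature T r := by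
  unfold extAvgCurvature
  simp only [totalCurvature_smul r hs, Pi.smul_apply, smul_eq_mul, ← Finset.mul_sum]
  rw [mul_div_mul_left _ _ hs.ne']

lemma flowField_smul (r : V → ℝ) {s : ℝ} (hs : 0 < s) :
    flowField T (s • r) = s • flowField T r := by
  funext i
  simp only [flowField, extAvgCurvature_smul r hs, extCurvature_smul r hs, Pi.smul_apply,
    smul_eq_mul]
  ring

lemma isConstantCurvaturePacking_smul {r : V → ℝ} (hr : IsConstantCurvaturePacking T r) {s : ℝ}
    (hs : 0 < s) : IsConstantCurvaturePacking T (s • r) := by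
  obtain ⟨hrM, c, hc⟩ := hr
  have hM := smul_mem_packings hrM hs
  exact ⟨hM, c, fun i => by
    rw [← extCurvature_eq hM, extCurvature_smul r hs, extCurvature_const hrM hc]⟩

lemma exists_flow [Nonempty V] {r : V → ℝ} (hr : IsConstantCurvaturePacking T r)
    {r₀ : V → ℝ} (hr₀ : r₀ ∈ packings T)
    (hgap : ((avgCurvature T r₀ : ℝ) : EReal) ≤ chi T r) :
    ∃ α : ℝ → V → ℝ, α 0 = r₀ ∧
      (∀ t ≥ 0, α t ∈ packings T ∧ HasDerivAt α (flowField T (α t)) t) ∧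
      ∃ q, IsConstantCurvaturePacking T q ∧
        ∃ C > 0, ∃ k > 0, ∀ t ≥ 0, ‖α t - q‖ ≤ C * Real.exp (-k * t) := by
  have hR0 := sum_pos_of_pos hr₀.1
  -- Curvatures are scale invariant and the field is homogeneous of degree one, so scaling maps
  -- solutions to solutions with the same time; `r₀` is scaled rather than `r`, which keeps `chi T
  -- r` unchanged.
  set s := (∑ i, r i) / ∑ i, r₀ i
  have hs : 0 < s := div_pos (sum_pos_of_pos hr.1.1) hR0
  have hs' := inv_pos.2 hs
  obtain ⟨α, h0, h1, q, hq, C, hC, k, hk, h2⟩ := exists_flow_normalized hr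
    (smul_mem_packings hr₀ hs)
    (by simp only [Pi.smul_apply, smul_eq_mul, ← Finset.mul_sum]; exact div_mul_cancel₀ _ hR0.ne')
    (by rwa [extAvgCurvature_smul r₀ hs, extAvgCurvature, ← avgCurvature_eq hr₀])
  refine ⟨fun t => s⁻¹ • α t, ?_, fun t ht => ⟨smul_mem_packings (h1 t ht).1 hs', ?_⟩, s⁻¹ • q,
    isConstantCurvaturePacking_smul hq hs', s⁻¹ * C, by positivity, k, hk, fun t ht => ?_⟩
  · simp only [h0, smul_smul, inv_mul_cancel₀ hs.ne', one_smul]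
  · rw [flowField_smul _ hs']
    exact (h1 t ht).2.const_smul s⁻¹
  · rw [← smul_sub, norm_smul, Real.norm_eq_abs, abs_of_pos hs', mul_assoc]
    exact mul_le_mul_of_nonneg_left (h2 t ht) hs'.le

lemma isNormalizedYamabeFlowOn_iff {α : ℝ → V → ℝ} {I : Set ℝ} :
    IsNormalizedYamabeFlowOn T α I ↔
      ∀ t ∈ I, α t ∈ packings T ∧ HasDerivWithinAt α (flowField T (α t)) I t := by
  refine forall₂_congr fun t _ => and_congr_right fun hM => ?_
  rw [hasDerivWithinAt_pi]
  simp only [flowField_eq hM]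

end BallPacking

end

theorem theorem1p2
    {M : Type*} [TopologicalSpace M] [T2Space M] [CompactSpace M]
    [ChartedSpace (EuclideanSpace ℝ (Fin 3)) M]
    {V : Type*} [Fintype V] [DecidableEq V] (T : AbstractSimplicialComplex V)
    (hT : BallPacking.Triangulates T M)
    (rhat : V → ℝ) (hrhat : BallPacking.IsConstantCurvaturePacking T rhat)
    (r₀ : V → ℝ) (hr₀ : r₀ ∈ BallPacking.packings T)
    (hgap : ((BallPacking.avgCurvature T r₀ : ℝ) : EReal) ≤ BallPacking.chi T rhat) :
    ∃ r : ℝ → V → ℝ,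
      r 0 = r₀ ∧
      BallPacking.IsNormalizedYamabeFlowOn T r (Set.Ici 0) ∧
      (∀ (τ : ℝ) (s : ℝ → V → ℝ), s 0 = r₀ →
        BallPacking.IsNormalizedYamabeFlowOn T s (Set.Ico 0 τ) →
        Set.EqOn s r (Set.Ico 0 τ)) ∧
      ∃ rinf : V → ℝ, BallPacking.IsConstantCurvaturePacking T rinf ∧
        ∃ C > 0, ∃ c > 0, ∀ t ≥ 0, ‖r t - rinf‖ ≤ C * Real.exp (-c * t) := by
  rcases isEmpty_or_nonempty V with hV | hV
  · refine ⟨fun _ => r₀, rfl, fun t _ => ⟨hr₀, fun i => (hV.false i).elim⟩,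
      fun τ s _ _ t _ => Subsingleton.elim _ _, rhat, hrhat, 1, one_pos, 1, one_pos,
      fun t _ => ?_⟩
    rw [Subsingleton.elim r₀ rhat, sub_self, norm_zero]
    positivity
  obtain ⟨α, h0, h1, q, hq, h2⟩ := BallPacking.exists_flow hrhat hr₀ hgap
  refine ⟨α, h0, BallPacking.isNormalizedYamabeFlowOn_iff.2 fun t ht =>
    ⟨(h1 t ht).1, (h1 t ht).2.hasDerivWithinAt⟩, fun τ s hs0 hs => ?_, q, hq, h2⟩
  exact solution_unique_of_contDiffAt (BallPacking.isOpen_packings T)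
    (fun p hp => BallPacking.contDiffAt_flowField hp) (hs0.trans h0.symm)
    (BallPacking.isNormalizedYamabeFlowOn_iff.1 hs)
    (fun t ht => ⟨(h1 t ht.1).1, (h1 t ht.1).2.hasDerivWithinAt⟩)
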